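/- Let $\alpha,\mu$ be positive integers, let $\Omega_s,\Omega_w>0$ with $\Omega_w^\alpha<\Omega_s^\alpha$, let $a_s,a_w>0$ with $a_s<a_w$ and $a_s+a_w=1$, and let $\rho,T,B>0$. Let $h_s,h_w$ be complex random variables (the channel coefficients of a strong and a weak user) such that the gains $g_i=|h_i|^2$, $i\in\{s,w\}$, are independent and $g_i$ has the $\alpha$-$\mu$ density $$f_{g_i}(x)=\frac{\alpha\mu^\mu x^{\alpha\mu/2-1}}{2\,\Omega_i^{\alpha\mu}\,\Gamma(\mu)}\exp\!\Big(-\frac{\mu x^{\alpha/2}}{\Omega_i^\alpha}\Big),\qquad x>0 .$$ Put $g_{\min}=\min\{g_w,g_s\}$, $\gamma_s=a_s\rho g_s$ and $\gamma_w=a_w\rho g_{\min}/(a_s\rho g_{\min}+1)$. For a delay exponent $\theta>0$ put $\nu=\theta TB/\ln 2$ and define the effective rates and the ergodic rates by $$R_i(\theta)=-\frac1\nu\log_2\mathbb E\big[(1+\gamma_i)^{-\nu}\big],\qquad C_i=\mathbb E\big[\log_2(1+\gamma_i)\big],\qquad i\in\{s,w\}.$$ Then all these expectations are finite, and the following hold.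 (1) For $i\in\{s,w\}$ and all $\theta>0$, $$R_i(\theta)\le-\frac1\nu\,\mathbb E\big[\log_2\{(1+\gamma_i)^{-\nu}\}\big]=C_i ,$$ where $C_i$ does not depend on $\theta$, and $R_i(\theta)\to C_i$ as $\theta\to0^+$. (2) Let $\Delta(k,y)$ denote the list $\frac yk,\frac{y+1}k,\dots,\frac{y+k-1}k$, and let $G^{m,n}_{p,q}$ denote Meijer's G-function, $$G^{m,n}_{p,q}\Big[z\,\Big|\,{a_1,\dots,a_p\atop b_1,\dots,b_q}\Big]=\frac1{2\pi i}\int_L\frac{\prod_{j\le m}\Gamma(b_j-s)\prod_{j\le n}\Gamma(1-a_j+s)}{\prod_{j>m}\Gamma(1-b_j+s)\prod_{j>n}\Gamma(a_j-s)}\,z^s\,ds ,$$ where $L$ is a vertical line, traversed upwards, with the poles of the $\Gamma(b_j-s)$, $j\le m$, on its right and the poles of the $\Gamma(1-a_j+s)$, $j\le n$, on its left. For the G-functions below such lines exist, and along each of them the integral converges absolutely and has the same value. For an integer $y\ge0$ put $\psi_y=\Delta(\alpha,-\tfrac12\alpha(\mu+y))$, $\phi_y=\Delta(\alpha,1-\tfrac12\alpha(\mu+y))$,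 and let $\zeta=\psi_0$, $\chi=\phi_0$. Then $$C_s=\frac{\mu^\mu\;G^{2+2\alpha,\alpha}_{2\alpha,2+2\alpha}\Big[\frac1{(a_s\rho)^\alpha}\big(\frac{\mu}{2\Omega_s^\alpha}\big)^2\,\Big|\,{\zeta,\ \chi\atop\Delta(2,0),\ \zeta,\ \zeta}\Big]}{\sqrt2\,(\ln2)\,(2\pi)^{\alpha-1/2}\,\Gamma(\mu)\,\Omega_s^{\alpha\mu}\,(a_s\rho)^{\alpha\mu/2}} .$$ (3) With $\tilde\Omega=\big(\Omega_s^{-\alpha}+\Omega_w^{-\alpha}\big)^{-1}$ and $$\mathcal G(x,y)=G^{2+2\alpha,\alpha}_{2\alpha,2+2\alpha}\Big[\frac1{x^\alpha}\Big(\frac{\mu}{2\tilde\Omega}\Big)^2\,\Big|\,{\psi_y,\ \phi_y\atop\Delta(2,0),\ \psi_y,\ \psi_y}\Big],$$ one has $$C_w=\frac1{\sqrt2(\ln2)(2\pi)^{\alpha-1/2}\Gamma(\mu)}\Bigg[\frac1{\Omega_s^{\alpha\mu}}\sum_{m=0}^{\mu-1}\frac{\mu^{\mu+m}}{m!\,\Omega_w^{m\alpha}}\Big\{\frac{\mathcal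 G(\rho,m)}{\rho^{\alpha(\mu+m)/2}}-\frac{\mathcal G(a_s\rho,m)}{(a_s\rho)^{\alpha(\mu+m)/2}}\Big\}+\frac1{\Omega_w^{\alpha\mu}}\sum_{n=0}^{\mu-1}\frac{\mu^{\mu+n}}{n!\,\Omega_s^{n\alpha}}\Big\{\frac{\mathcal G(\rho,n)}{\rho^{\alpha(\mu+n)/2}}-\frac{\mathcal G(a_s\rho,n)}{(a_s\rho)^{\alpha(\mu+n)/2}}\Big\}\Bigg].$$ (4) For all $\theta>0$, $R_s(\theta)+R_w(\theta)\le C_s+C_w$, and $C_s+C_w$ is the sum of the closed forms in (2) and (3). -/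

import Mathlib

open MeasureTheory ProbabilityTheory Filter Topology

noncomputable section

/-! ### Meijer's G-function -/

/-- The Mellin-Barnes integrand of Meijer's function `G^{m,n}_{p,q}[z | a; b]`, with `p` and `q`
the lengths of the lists `a` and `b`:
`∏_{j ≤ m} Γ(b_j - s) ∏_{j ≤ n} Γ(1 - a_j + s) /
  (∏_{j > m} Γ(1 - b_j + s) ∏_{j > n} Γ(a_j - s)) * z ^ s`. -/
def meijerGIntegrand (m n : ℕ) (a b : List ℂ) (z s : ℂ) : ℂ :=
  (((b.take m).map fun bj => Complex.Gamma (bj - s)).prod *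
      ((a.take n).map fun aj => Complex.Gamma (1 - aj + s)).prod) /
    (((b.drop m).map fun bj => Complex.Gamma (1 - bj + s)).prod *
      ((a.drop n).map fun aj => Complex.Gamma (aj - s)).prod) * z ^ s

/-- The vertical line `Re s = c` separates the poles `b_j + k` of the factors `Γ(b_j - s)`, `j ≤ m`,
(to its right) from the poles `a_j - 1 - k` of the factors `Γ(1 - a_j + s)`, `j ≤ n`,
(to its left). -/
def MeijerGSeparates (m n : ℕ) (a b : List ℂ) (c : ℝ) : Prop :=
  (∀ bj ∈ b.take m, c < bj.re) ∧ (∀ aj ∈ a.take n, aj.re - 1 < c)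

/-- `(1 / 2πi) ∫` of the Mellin-Barnes integrand along `Re s = c`, from `c - i∞` to `c + i∞`. -/
def meijerGLine (m n : ℕ) (a b : List ℂ) (z : ℂ) (c : ℝ) : ℂ :=
  (1 / (2 * Real.pi) : ℂ) * ∫ t : ℝ, meijerGIntegrand m n a b z (c + t * Complex.I)

open Classical in
/-- Meijer's function `G^{m,n}_{p,q}[z | a; b]`: the Mellin-Barnes integral along a vertical line
that separates the two families of poles (and `0` by convention if there is no such line). -/
def meijerG (m n : ℕ) (a b : List ℂ) (z : ℂ) : ℂ :=
  if h : ∃ c : ℝ, MeijerGSeparates m n a b c then meijerGLine m n a b z h.choose else 0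

/-- Meijer's function is genuinely given by its defining integral: a separating line exists, and
along every separating line the integral converges absolutely and has the value `meijerG`. -/
def MeijerGWellDefined (m n : ℕ) (a b : List ℂ) (z : ℂ) : Prop :=
  (∃ c : ℝ, MeijerGSeparates m n a b c) ∧
    ∀ c : ℝ, MeijerGSeparates m n a b c →
      Integrable (fun t : ℝ => meijerGIntegrand m n a b z (c + t * Complex.I)) ∧
        meijerGLine m n a b z c = meijerG m n a b z

/-- `Δ(k, y) = y / k, (y + 1) / k, …, (y + k - 1) / k`. -/
def deltaList (k : ℕ) (y : ℂ) : List ℂ :=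
  (List.range k).map fun j => (y + (j : ℂ)) / (k : ℂ)

/-- Upper parameters `Δ(α, -αM/2), Δ(α, 1 - αM/2)`. -/
def upperParams (α M : ℕ) : List ℂ :=
  deltaList α (-((α : ℂ) * (M : ℂ) / 2)) ++ deltaList α (1 - (α : ℂ) * (M : ℂ) / 2)

/-- Lower parameters `Δ(2, 0), Δ(α, -αM/2), Δ(α, -αM/2)`. -/
def lowerParams (α M : ℕ) : List ℂ :=
  deltaList 2 0 ++ deltaList α (-((α : ℂ) * (M : ℂ) / 2)) ++
    deltaList α (-((α : ℂ) * (M : ℂ) / 2))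

/-! ### The two-user downlink NOMA system -/

/-- The two users: `s` (strong) and `w` (weak). -/
inductive NOMAUser : Type
  | s : NOMAUser
  | w : NOMAUser

/-- The probability density of the channel gain `|h|²` of an `α`-`μ` fading link with parameter `Ω`,
the `α`-root-mean value of `|h|`. -/
def alphaMuGainPDF (α μ : ℕ) (Ω x : ℝ) : ℝ :=
  if 0 < x then
    (α : ℝ) * (μ : ℝ) ^ μ * x ^ ((α : ℝ) * (μ : ℝ) / 2 - 1) /
        (2 * Ω ^ (α * μ) * Real.Gamma (μ : ℝ)) *
      Real.exp (-((μ : ℝ) * x ^ ((α : ℝ) / 2) / Ω ^ α))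
  else 0

/-- The law of the channel gain of an `α`-`μ` fading link. -/
def alphaMuGainLaw (α μ : ℕ) (Ω : ℝ) : Measure ℝ :=
  volume.withDensity fun x => ENNReal.ofReal (alphaMuGainPDF α μ Ω x)

section System

variable {S : Type*}

/-- The channel gain `g_i = |h_i|²`. -/
def channelGain (h : NOMAUser → S → ℂ) (i : NOMAUser) (ω : S) : ℝ := ‖h i ω‖ ^ 2

/-- `g_min = min {g_w, g_s}`. -/
def minGain (h : NOMAUser → S → ℂ) (ω : S) : ℝ :=
  min (channelGain h NOMAUser.w ω) (channelGain h NOMAUser.s ω)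

/-- The received SNR `γ_s = a_s ρ g_s` and SINR `γ_w = a_w ρ g_min / (a_s ρ g_min + 1)`. -/
def sinr (a : NOMAUser → ℝ) (ρ : ℝ) (h : NOMAUser → S → ℂ) : NOMAUser → S → ℝ
  | NOMAUser.s, ω => a NOMAUser.s * ρ * channelGain h NOMAUser.s ω
  | NOMAUser.w, ω =>
      a NOMAUser.w * ρ * minGain h ω / (a NOMAUser.s * ρ * minGain h ω + 1)

/-- `ν = θ T B / ln 2`. -/
def qosNu (θ T B : ℝ) : ℝ := θ * T * B / Real.log 2

variable [MeasurableSpace S]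

/-- The effective rate `R_i = -(1/ν) log₂ E[(1 + γ_i)^(-ν)]`. -/
def effectiveRate (P : Measure S) (a : NOMAUser → ℝ) (ρ T B : ℝ) (h : NOMAUser → S → ℂ)
    (i : NOMAUser) (θ : ℝ) : ℝ :=
  -(1 / qosNu θ T B) * Real.logb 2 (∫ ω, (1 + sinr a ρ h i ω) ^ (-qosNu θ T B) ∂P)

/-- The sum effective rate `R_sum = R_s + R_w`. -/
def sumEffectiveRate (P : Measure S) (a : NOMAUser → ℝ) (ρ T B : ℝ) (h : NOMAUser → S → ℂ)
    (θ : ℝ) : ℝ :=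
  effectiveRate P a ρ T B h NOMAUser.s θ + effectiveRate P a ρ T B h NOMAUser.w θ

/-- The ergodic rate `C_i = E[log₂(1 + γ_i)]`. -/
def ergodicRate (P : Measure S) (a : NOMAUser → ℝ) (ρ : ℝ) (h : NOMAUser → S → ℂ)
    (i : NOMAUser) : ℝ :=
  ∫ ω, Real.logb 2 (1 + sinr a ρ h i ω) ∂P

/-- The ergodic sum-rate `C_sum = C_s + C_w`. -/
def ergodicSumRate (P : Measure S) (a : NOMAUser → ℝ) (ρ : ℝ) (h : NOMAUser → S → ℂ) : ℝ :=
  ergodicRate P a ρ h NOMAUser.s + ergodicRate P a ρ h NOMAUser.w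

end System

/-- `Ω̃ = 1 / (1 / Ω_s^α + 1 / Ω_w^α)`. -/
def omegaTilde (α : ℕ) (Ω : NOMAUser → ℝ) : ℝ :=
  1 / (1 / Ω NOMAUser.s ^ α + 1 / Ω NOMAUser.w ^ α)

/-- The argument `x^(-α) (μ / (2 Ω̃))²` of the G-functions in the weak user's ergodic rate. -/
def weakArg (α μ : ℕ) (Ω : NOMAUser → ℝ) (x : ℝ) : ℝ :=
  1 / x ^ α * ((μ : ℝ) / (2 * omegaTilde α Ω)) ^ 2

/-- `𝒢(x, y)`, the G-function `G^{2+2α,α}_{2α,2+2α}` in the weak user's ergodic rate. -/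
def weakG (α μ : ℕ) (Ω : NOMAUser → ℝ) (x : ℝ) (y : ℕ) : ℂ :=
  meijerG (2 + 2 * α) α (upperParams α (μ + y)) (lowerParams α (μ + y)) (weakArg α μ Ω x : ℂ)

/-- The argument `(a_s ρ)^(-α) (μ / (2 Ω_s^α))²` of the G-function in the strong user's
ergodic rate. -/
def strongArg (α μ : ℕ) (Ω a : NOMAUser → ℝ) (ρ : ℝ) : ℝ :=
  1 / (a NOMAUser.s * ρ) ^ α * ((μ : ℝ) / (2 * Ω NOMAUser.s ^ α)) ^ 2

/-- The closed form of the strong user's ergodic rate. -/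
def strongClosedForm (α μ : ℕ) (Ω a : NOMAUser → ℝ) (ρ : ℝ) : ℂ :=
  (μ : ℂ) ^ μ *
      meijerG (2 + 2 * α) α (upperParams α μ) (lowerParams α μ) (strongArg α μ Ω a ρ : ℂ) /
    ((√2 * Real.log 2 * (2 * Real.pi) ^ ((α : ℝ) - 1 / 2) * Real.Gamma (μ : ℝ) *
      Ω NOMAUser.s ^ (α * μ) * (a NOMAUser.s * ρ) ^ ((α : ℝ) * (μ : ℝ) / 2) : ℝ) : ℂ)

/-- The difference `𝒢(ρ, y) / ρ^(α(μ+y)/2) - 𝒢(a_s ρ, y) / (a_s ρ)^(α(μ+y)/2)`. -/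
def weakBracket (α μ : ℕ) (Ω a : NOMAUser → ℝ) (ρ : ℝ) (y : ℕ) : ℂ :=
  weakG α μ Ω ρ y / ((ρ ^ ((α : ℝ) * ((μ : ℝ) + (y : ℝ)) / 2) : ℝ) : ℂ) -
    weakG α μ Ω (a NOMAUser.s * ρ) y /
      (((a NOMAUser.s * ρ) ^ ((α : ℝ) * ((μ : ℝ) + (y : ℝ)) / 2) : ℝ) : ℂ)

/-- The closed form of the weak user's ergodic rate. -/
def weakClosedForm (α μ : ℕ) (Ω a : NOMAUser → ℝ) (ρ : ℝ) : ℂ :=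
  1 / ((√2 * Real.log 2 * (2 * Real.pi) ^ ((α : ℝ) - 1 / 2) * Real.Gamma (μ : ℝ) : ℝ) : ℂ) *
    (1 / (Ω NOMAUser.s : ℂ) ^ (α * μ) *
        ∑ m ∈ Finset.range μ,
          (μ : ℂ) ^ (μ + m) / ((m.factorial : ℂ) * (Ω NOMAUser.w : ℂ) ^ (m * α)) *
            weakBracket α μ Ω a ρ m +
      1 / (Ω NOMAUser.w : ℂ) ^ (α * μ) *
        ∑ n ∈ Finset.range μ,
          (μ : ℂ) ^ (μ + n) / ((n.factorial : ℂ) * (Ω NOMAUser.s : ℂ) ^ (n * α)) *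
            weakBracket α μ Ω a ρ n)

end

/-! Both ergodic rates reduce to the integrals J(M, x, l) = ∫₀^∞ log(1 + xu) u^(αM/2-1) exp(-l
u^(α/2)) du, and each J is a Meijer G-function up to an explicit factor.

Reduction to J. For the strong user J is read off the density. For the weak user, a_s + a_w = 1
gives log(1 + γ_w) = log(1 + ρ g_min) - log(1 + a_s ρ g_min). The expectation of log(1 + x g_min)
splits according to which gain is smaller, each half integrating the density of one gain against the
tail of the other. Since μ is an integer, that tail is exp(-v) ∑_{m<μ} v^m/m! with v proportional to
u^(α/2), so every term is again a J, with M = μ + m and the two exponential rates added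
(`integral_tail_mul_log_one_add_mul`).

J as a G-function. The Mellin transform of log(1 + y) is Γ(-s)Γ(1+s)/(-s) on -1 < Re s < 0. It is
integrable on vertical lines, so Mellin inversion and Fubini give a Parseval formula
(`integral_log_one_add_mul_eq`) that writes J as a line integral of this transform against the
Gamma-type transform of the kernel. Conversely the G-integrand collapses to the same product
(`meijerGIntegrand_eq`): the duplication formula handles Δ(2,0), and shift and reflection identities
for products of Γ((w+j)/α) handle the other lists. An affine change of variable matches the two
lines; since the argument works on every separating line, it also gives absolute convergence and
independence of the line.

Effective rates. With Y = log(1 + γ), the rate is -(1/ν) log E[exp(-νY)] up to the factor 1/log 2.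
Jensen bounds it by the ergodic rate, and a squeeze with dominated convergence gives the limit. -/

noncomputable section

/-! ### Products of Gamma factors and the G-integrand -/

/-- The product formula `∏_{j < n} sin (v + jπ/n) = sin (n v) / 2 ^ (n - 1)`. -/
theorem prod_sin_add_mul_pi_div {n : ℕ} (hn : 0 < n) (v : ℂ) :
    ∏ j ∈ Finset.range n, Complex.sin (v + j * Real.pi / n) =
      Complex.sin (n * v) / 2 ^ (n - 1) := by
  have hn' : (n : ℂ) ≠ 0 := by exact_mod_cast hn.ne'
  have hprim := Complex.isPrimitiveRoot_exp n hn.ne'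
  set ζ := Complex.exp (2 * Real.pi * Complex.I / n) with hζ
  -- The factorisation of X^n - a^n over the n-th roots of unity, at X = 1 with a = e^(2iv). Each
  -- sine is one such factor times an exponential phase.
  have hroots : 1 - Complex.exp (2 * v * Complex.I) ^ n =
      ∏ j ∈ Finset.range n, (1 - ζ ^ j * Complex.exp (2 * v * Complex.I)) := by
    have h1 := congrArg (Polynomial.eval 1) (X_pow_sub_C_eq_prod hprim hn
      (rfl : Complex.exp (2 * v * Complex.I) ^ n = _))
    simpa [Polynomial.eval_prod] using h1
  have hfac : ∀ j : ℕ, Complex.sin (v + j * Real.pi / n) =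
      (Complex.I / 2) * Complex.exp (-Complex.I * (v + j * Real.pi / n)) *
        (1 - ζ ^ j * Complex.exp (2 * v * Complex.I)) := by
    intro j
    rw [hζ, ← Complex.exp_nat_mul, ← Complex.exp_add, Complex.sin, mul_sub, mul_one, mul_assoc,
      ← Complex.exp_add]
    have e : -Complex.I * (v + j * Real.pi / n) +
        (j * (2 * Real.pi * Complex.I / n) + 2 * v * Complex.I) =
        (v + j * Real.pi / n) * Complex.I := by
      field_simp; ring
    rw [e]
    ring_nf
  -- The phases multiply to a power of -i because ∑ j = n(n-1)/2.
  have hphase : ∏ j ∈ Finset.range n, Complex.exp (-Complex.I * (v + j * Real.pi / n)) =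
      Complex.exp (-Complex.I * (n * v)) * (-Complex.I) ^ (n - 1) := by
    rw [← Complex.exp_sum, ← Finset.mul_sum, Finset.sum_add_distrib, ← Finset.sum_div,
      ← Finset.sum_mul]
    have hs : (∑ j ∈ Finset.range n, (j : ℂ)) = n * (n - 1 : ℕ) / 2 := by
      rw [eq_div_iff two_ne_zero]
      have := congrArg (Nat.cast : ℕ → ℂ) (Finset.sum_range_id_mul_two n)
      simpa only [Nat.cast_mul, Nat.cast_sum, Nat.cast_ofNat] using this
    have hI : -Complex.I = Complex.exp (-(Real.pi / 2) * Complex.I) := by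
      rw [neg_mul, Complex.exp_neg, Complex.exp_pi_div_two_mul_I, Complex.inv_I]
    rw [hs, Finset.sum_const, Finset.card_range, nsmul_eq_mul]
    nth_rw 3 [hI]
    rw [← Complex.exp_nat_mul, ← Complex.exp_add]
    congr 1
    field_simp
    ring
  simp_rw [hfac]
  rw [Finset.prod_mul_distrib, Finset.prod_mul_distrib, ← hroots, hphase, Finset.prod_const,
    Finset.card_range, ← Complex.exp_nat_mul, Complex.sin]
  obtain ⟨m, rfl⟩ : ∃ m, n = m + 1 := ⟨n - 1, by omega⟩
  simp only [Nat.add_sub_cancel]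
  have hII : (Complex.I / 2) ^ (m + 1) * (-Complex.I) ^ m = Complex.I / 2 / 2 ^ m := by
    rw [pow_succ, mul_right_comm, ← mul_pow,
      show Complex.I / 2 * -Complex.I = 1 / 2 by
        linear_combination (-1 / 2 : ℂ) * Complex.I_mul_I, one_div, inv_pow]
    ring
  calc _ = ((Complex.I / 2) ^ (m + 1) * (-Complex.I) ^ m) *
        (Complex.exp (-Complex.I * ((m + 1 : ℕ) * v)) -
          Complex.exp (-Complex.I * ((m + 1 : ℕ) * v) + (m + 1 : ℕ) * (2 * v * Complex.I))) := by
        rw [Complex.exp_add]; ring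
    _ = _ := by
        rw [hII]
        ring_nf

/-- `∏_{j < n} Γ((w + j)/n) Γ(1 - (w + j)/n) = (2π)^(n-1) Γ(w) Γ(1 - w)`. -/
theorem prod_Gamma_mul_Gamma_one_sub {n : ℕ} (hn : 0 < n) (w : ℂ) :
    ∏ j ∈ Finset.range n, (Complex.Gamma ((w + j) / n) * Complex.Gamma (1 - (w + j) / n)) =
      (2 * Real.pi) ^ (n - 1) * (Complex.Gamma w * Complex.Gamma (1 - w)) := by
  have hn' : (n : ℂ) ≠ 0 := by exact_mod_cast hn.ne'
  simp_rw [Complex.Gamma_mul_Gamma_one_sub]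
  rw [Finset.prod_div_distrib, Finset.prod_const, Finset.card_range]
  have h := prod_sin_add_mul_pi_div hn (Real.pi * w / n)
  rw [show (n : ℂ) * (Real.pi * w / n) = Real.pi * w by field_simp] at h
  have h2 : ∏ j ∈ Finset.range n, Complex.sin (Real.pi * ((w + j) / n)) =
      Complex.sin (Real.pi * w) / 2 ^ (n - 1) := by
    rw [← h]
    refine Finset.prod_congr rfl fun j _ => ?_
    congr 1; ring
  rw [h2]
  obtain ⟨m, rfl⟩ : ∃ m, n = m + 1 := ⟨n - 1, by omega⟩
  simp only [Nat.add_sub_cancel]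
  rw [mul_pow, div_div_eq_mul_div, pow_succ]
  ring

/-- The two products share all factors but the end ones, Γ(w/n + 1) and Γ(w/n), whose ratio is w/n.
This is how the lists starting at -αM/2 and 1 - αM/2 nearly cancel. -/
theorem prod_Gamma_add_one_div {n : ℕ} (hn : 0 < n) {w : ℂ} (hw : 0 < w.re) :
    ∏ j ∈ Finset.range n, Complex.Gamma ((w + j + 1) / n) =
      w / n * ∏ j ∈ Finset.range n, Complex.Gamma ((w + j) / n) := by
  have hn' : (n : ℂ) ≠ 0 := by exact_mod_cast hn.ne'
  have hw0 : w ≠ 0 := by rintro rfl; simp at hw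
  have hre : 0 < (w / n).re := by
    rw [Complex.div_natCast_re]; positivity
  have h0 := Complex.Gamma_ne_zero_of_re_pos hre
  have h1 := Finset.prod_range_succ (fun j : ℕ => Complex.Gamma ((w + j) / n)) n
  rw [Finset.prod_range_succ'] at h1
  simp only [Nat.cast_zero, add_zero, Nat.cast_add, Nat.cast_one] at h1
  rw [add_div, div_self hn', Complex.Gamma_add_one _ (div_ne_zero hw0 hn')] at h1
  apply mul_right_cancel₀ h0
  simp_rw [add_assoc]
  rw [h1]
  ring

theorem prod_map_deltaList (k : ℕ) (y : ℂ) (f : ℂ → ℂ) :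
    ((deltaList k y).map f).prod = ∏ j ∈ Finset.range k, f ((y + j) / k) := by
  have h : (deltaList k y).map f = (List.range k).map fun j : ℕ => f ((y + j) / k) := by
    simp [deltaList, Function.comp_def, ← List.map_eq_flatMap]
  rw [h]
  rfl

@[simp] theorem length_deltaList (k : ℕ) (y : ℂ) : (deltaList k y).length = k := by
  simp [deltaList]

theorem take_upperParams (α M : ℕ) :
    (upperParams α M).take α = deltaList α (-((α : ℂ) * (M : ℂ) / 2)) := by
  rw [upperParams, List.take_left' (by simp)]

theorem drop_upperParams (α M : ℕ) :
    (upperParams α M).drop α = deltaList α (1 - (α : ℂ) * (M : ℂ) / 2) := by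
  rw [upperParams, List.drop_left' (by simp)]

theorem take_lowerParams (α M : ℕ) :
    (lowerParams α M).take (2 + 2 * α) = lowerParams α M := by
  rw [List.take_of_length_le]
  simp [lowerParams]; omega

theorem drop_lowerParams (α M : ℕ) :
    (lowerParams α M).drop (2 + 2 * α) = [] := by
  rw [List.drop_eq_nil_iff]
  simp [lowerParams]; omega

/-- The Mellin transform of `y ↦ log (1 + y)` in the strip `-1 < Re s < 0`. -/
def logMellin (s : ℂ) : ℂ := Complex.Gamma (-s) * Complex.Gamma (1 + s) / (-s)

/-- In the variable w the factors over the lists of length α are ∏Γ((w+j)/α) twice and ∏Γ(1-(w+j)/α)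
above, ∏Γ((w+j+1)/α) below. One copy cancels against the denominator to leave α/w; the other pairs
with the reflected product to leave (2π)^(α-1) Γ(w)Γ(1-w). Together they form the Mellin transform
of log(1 + y) at -w. -/
theorem meijerGIntegrand_eq {α : ℕ} (M : ℕ) (hα : 0 < α) {x l : ℝ} (hx : 0 < x) (hl : 0 < l)
    {s w : ℂ} (hw : w = -((α : ℂ) * M / 2) - α * s) (h0 : 0 < w.re) :
    meijerGIntegrand (2 + 2 * α) α (upperParams α M) (lowerParams α M)
        ((1 / x ^ α * (l / 2) ^ 2 : ℝ) : ℂ) s =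
      2 * √Real.pi * α * (2 * Real.pi) ^ (α - 1) *
        (logMellin (-w) * (x : ℂ) ^ (α * M / 2 + w) *
          (Complex.Gamma (-2 * s) * (l : ℂ) ^ (2 * s))) := by
  have hα' : (α : ℂ) ≠ 0 := by exact_mod_cast hα.ne'
  have hw0 : w ≠ 0 := by rintro rfl; simp at h0
  have hP : ∏ j ∈ Finset.range α, Complex.Gamma ((w + j) / α) ≠ 0 := by
    refine Finset.prod_ne_zero_iff.2 fun j _ => Complex.Gamma_ne_zero_of_re_pos ?_
    rw [Complex.div_natCast_re]
    have : (0 : ℝ) < α := by exact_mod_cast hα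
    simp only [Complex.add_re, Complex.natCast_re]
    positivity
  have hpsi : ∀ j : ℕ, (-((α : ℂ) * M / 2) + j) / α - s = (w + j) / α := by
    intro j; rw [hw]; field_simp; ring
  have hpsi' : ∀ j : ℕ, 1 - (-((α : ℂ) * M / 2) + j) / α + s = 1 - (w + j) / α := by
    intro j; rw [hw]; field_simp; ring
  have hphi : ∀ j : ℕ, (1 - (α : ℂ) * M / 2 + j) / α - s = (w + j + 1) / α := by
    intro j; rw [hw]; field_simp; ring
  rw [meijerGIntegrand, take_lowerParams, drop_lowerParams, take_upperParams, drop_upperParams,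
    lowerParams]
  simp only [List.map_append, List.prod_append, prod_map_deltaList, List.map_nil, List.prod_nil,
    one_mul, hpsi, hpsi', hphi, prod_Gamma_add_one_div hα h0]
  -- Legendre duplication at -s; the resulting power of 2 is absorbed into z^s below.
  have hdup : ∏ j ∈ Finset.range 2, Complex.Gamma ((0 + (j : ℂ)) / (2 : ℕ) - s) =
      Complex.Gamma (-2 * s) * 2 ^ (1 + 2 * s) * √Real.pi := by
    have := Complex.Gamma_mul_Gamma_add_half (-s)
    rw [Finset.prod_range_succ, Finset.prod_range_one]
    convert this using 3 <;> (try push_cast) <;> ring_nf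
  have hrefl := prod_Gamma_mul_Gamma_one_sub hα w
  rw [Finset.prod_mul_distrib] at hrefl
  have hz : ((1 / x ^ α * (l / 2) ^ 2 : ℝ) : ℂ) ^ s * 2 ^ (1 + 2 * s) =
      2 * ((x : ℂ) ^ (α * M / 2 + w) * (l : ℂ) ^ (2 * s)) := by
    have hzpos : 0 < 1 / x ^ α * (l / 2) ^ 2 := by positivity
    have hlog : Real.log (1 / x ^ α * (l / 2) ^ 2) =
        -(α * Real.log x) + 2 * (Real.log l - Real.log 2) := by
      rw [Real.log_mul (by positivity) (by positivity), one_div, Real.log_inv, Real.log_pow,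
        Real.log_pow, Real.log_div hl.ne' two_ne_zero]
      norm_num
    rw [Complex.cpow_add _ _ two_ne_zero, Complex.cpow_one,
      Complex.cpow_def_of_ne_zero (by exact_mod_cast hzpos.ne'),
      Complex.cpow_def_of_ne_zero two_ne_zero,
      Complex.cpow_def_of_ne_zero (by exact_mod_cast hx.ne'),
      Complex.cpow_def_of_ne_zero (by exact_mod_cast hl.ne'), ← Complex.ofReal_log hzpos.le,
      ← Complex.ofReal_log hx.le, ← Complex.ofReal_log hl.le, hlog, mul_left_comm, ← Complex.exp_add,
      ← Complex.exp_add, show (Complex.log 2) = ((Real.log 2 : ℝ) : ℂ) by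
        rw [Complex.ofReal_log (by norm_num)]; norm_num]
    congr 2
    rw [hw]; push_cast; ring
  rw [hdup, logMellin]
  set Q := ∏ j ∈ Finset.range α, Complex.Gamma ((w + j) / α)
  set R := ∏ j ∈ Finset.range α, Complex.Gamma (1 - (w + j) / α)
  calc _ = Complex.Gamma (-2 * s) * √Real.pi * (Q * R) * (Q / (w / α * Q)) *
        (((1 / x ^ α * (l / 2) ^ 2 : ℝ) : ℂ) ^ s * 2 ^ (1 + 2 * s)) := by ring
    _ = _ := by
      rw [hz, hrefl]
      have : Q / (w / α * Q) = α / w := by field_simp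
      rw [this]
      simp only [neg_neg, ← sub_eq_add_neg]
      ring

/-! ### The Mellin transform of log(1 + y) -/

/-- The known value of the integral is positive, whereas the integral of a non-integrable function
is 0 by default. -/
theorem integrableOn_rpow_mul_exp_neg_mul_rpow_of_pos {p q b : ℝ} (hp : 0 < p) (hq : -1 < q)
    (hb : 0 < b) :
    IntegrableOn (fun u : ℝ => u ^ q * Real.exp (-b * u ^ p)) (Set.Ioi 0) := by
  by_contra h
  have h1 := integral_rpow_mul_exp_neg_mul_rpow hp hq hb
  rw [integral_undef h] at h1
  have h2 : 0 < Real.Gamma ((q + 1) / p) := Real.Gamma_pos_of_pos (div_pos (by linarith) hp)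
  have : 0 < b ^ (-(q + 1) / p) * (1 / p) * Real.Gamma ((q + 1) / p) := by positivity
  linarith

theorem norm_ofReal_cpow_mul_ofReal {u : ℝ} (hu : 0 < u) (s : ℂ) {v : ℝ} (hv : 0 ≤ v) :
    ‖(u : ℂ) ^ s * (v : ℂ)‖ = u ^ s.re * v := by
  rw [norm_mul, Complex.norm_cpow_eq_rpow_re_of_pos hu, Complex.norm_real, Real.norm_of_nonneg hv]

/-- `∫₀^∞ y ^ (p - 1) / (1 + y) dy = Γ(p) Γ(1 - p)`. -/
theorem integral_cpow_div_one_add {p : ℂ} (h0 : 0 < p.re) (h1 : p.re < 1) :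
    ∫ y in Set.Ioi (0 : ℝ), (y : ℂ) ^ (p - 1) * ((1 / (1 + y) : ℝ) : ℂ) =
      Complex.Gamma p * Complex.Gamma (1 - p) := by
  set ν : Measure ℝ := volume.restrict (Set.Ioi 0) with hν
  -- Write 1/(1+y) = ∫₀^∞ e^(-(1+y)r) dr and swap: the y-integral gives Γ(p) r^(-p) e^(-r), and the
  -- r-integral then gives Γ(1-p).
  set F : ℝ → ℝ → ℂ := fun r y => (y : ℂ) ^ (p - 1) * ((Real.exp (-((1 + y) * r)) : ℝ) : ℂ)
  have hnorm : ∀ r, 0 < r → ∀ᵐ y ∂ν, ‖F r y‖ =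
      Real.exp (-r) * (y ^ (p.re - 1) * Real.exp (-(r * y))) := by
    intro r hr
    filter_upwards [ae_restrict_mem measurableSet_Ioi] with y hy
    rw [norm_ofReal_cpow_mul_ofReal hy _ (Real.exp_pos _).le, Complex.sub_re, Complex.one_re,
      mul_left_comm, ← Real.exp_add]
    ring_nf
  have hmeas : Measurable (Function.uncurry F) := by
    simp only [F, Function.uncurry_def]
    fun_prop
  have hint : ∀ r, 0 < r → Integrable (F r) ν := by
    intro r hr
    have h2 := (integrableOn_rpow_mul_exp_neg_mul_rpow_of_pos one_pos
      (show (-1 : ℝ) < p.re - 1 by linarith) hr).const_mul (Real.exp (-r))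
    refine Integrable.mono' h2 (hmeas.comp measurable_prodMk_left).aestronglyMeasurable ?_
    filter_upwards [hnorm r hr] with y hy
    rw [hy]
    simp
  have hprod : Integrable (Function.uncurry F) (ν.prod ν) := by
    rw [integrable_prod_iff hmeas.aestronglyMeasurable]
    refine ⟨?_, ?_⟩
    · filter_upwards [ae_restrict_mem measurableSet_Ioi] with r hr using hint r hr
    · have h3 : Integrable (fun r : ℝ =>
          Real.Gamma p.re * (r ^ (-p.re) * Real.exp (-1 * r ^ (1 : ℝ)))) ν :=
        (integrableOn_rpow_mul_exp_neg_mul_rpow_of_pos one_pos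
          (show (-1 : ℝ) < -p.re by linarith) one_pos).const_mul _
      refine h3.congr ?_
      filter_upwards [ae_restrict_mem measurableSet_Ioi] with r hr
      have hr' : 0 < r := hr
      simp only [Function.uncurry_apply_pair]
      rw [integral_congr_ae (hnorm r hr'), integral_const_mul, hν,
        Real.integral_rpow_mul_exp_neg_mul_Ioi h0 hr', Real.rpow_neg hr'.le, one_div,
        Real.inv_rpow hr'.le, Real.rpow_one]
      ring_nf
  have hswap := integral_integral_swap hprod
  have hl : ∫ r, ∫ y, F r y ∂ν ∂ν = Complex.Gamma p * Complex.Gamma (1 - p) := by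
    rw [Complex.Gamma_eq_integral (s := 1 - p) (by simpa using h1), Complex.GammaIntegral,
      ← integral_const_mul]
    refine integral_congr_ae ?_
    filter_upwards [ae_restrict_mem measurableSet_Ioi] with r hr
    have hr' : 0 < r := hr
    have h4 := Complex.integral_cpow_mul_exp_neg_mul_Ioi h0 hr'
    have h5 : ∫ y, F r y ∂ν = ((Real.exp (-r) : ℝ) : ℂ) *
        ∫ y in Set.Ioi (0 : ℝ), (y : ℂ) ^ (p - 1) * Complex.exp (-(r * y)) := by
      rw [← integral_const_mul]
      refine integral_congr_ae (Eventually.of_forall fun y => ?_)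
      simp only [F]
      rw [mul_left_comm]
      push_cast
      rw [← Complex.exp_add]
      ring_nf
    rw [h5, h4, one_div, Complex.inv_cpow _ _ (by
      rw [Complex.arg_ofReal_of_nonneg hr'.le]; exact Real.pi_pos.ne), ← Complex.cpow_neg]
    ring_nf
  rw [← hl, hswap]
  refine integral_congr_ae ?_
  filter_upwards [ae_restrict_mem measurableSet_Ioi] with y hy
  have hy' : 0 < 1 + y := by have : 0 < y := hy; linarith
  simp only [F]
  rw [integral_const_mul, integral_complex_ofReal]
  congr 2
  have := Real.integral_rpow_mul_exp_neg_mul_Ioi one_pos hy'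
  simpa using this.symm

/-- Apply log t ≤ t - 1 to t = (1+y)^ε ≤ 1 + y^ε. Taking ε = 1 controls the behaviour at 0, small ε
that at infinity. -/
theorem log_one_add_le_rpow_div {y ε : ℝ} (hy : 0 ≤ y) (h0 : 0 < ε) (h1 : ε ≤ 1) :
    Real.log (1 + y) ≤ y ^ ε / ε := by
  have hpos : 0 < 1 + y := by linarith
  have h2 : (1 + y) ^ ε ≤ 1 + y ^ ε := by
    simpa using Real.rpow_add_le_add_rpow zero_le_one hy h0.le h1
  rw [le_div_iff₀ h0, mul_comm, ← Real.log_rpow hpos]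
  have h3 := Real.log_le_sub_one_of_pos (Real.rpow_pos_of_pos hpos ε)
  linarith

theorem mellinConvergent_log_one_add {s : ℂ} (h0 : -1 < s.re) (h1 : s.re < 0) :
    MellinConvergent (fun y : ℝ => ((Real.log (1 + y) : ℝ) : ℂ)) s := by
  -- Any exponent strictly between Re s and 0 serves at infinity; the midpoint is taken. At 0 the
  -- bound is linear.
  refine mellinConvergent_of_isBigO_rpow (a := s.re / 2) (b := -1) ?_ ?_ (by linarith) ?_ h0
  · refine ContinuousOn.locallyIntegrableOn (fun y hy => ?_) measurableSet_Ioi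
    have hy' : 0 < y := hy
    have : 1 + y ≠ 0 := by positivity
    refine ContinuousAt.continuousWithinAt ?_
    fun_prop (disch := assumption)
  · refine Asymptotics.IsBigO.of_bound (1 / (-(s.re / 2))) ?_
    filter_upwards [eventually_gt_atTop 0] with y hy
    rw [Complex.norm_real, Real.norm_of_nonneg (Real.log_nonneg (by linarith)),
      Real.norm_of_nonneg (by positivity)]
    have := log_one_add_le_rpow_div hy.le (ε := -(s.re / 2)) (by linarith) (by linarith)
    rwa [div_eq_mul_one_div, mul_comm] at this
  · refine Asymptotics.IsBigO.of_bound 1 ?_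
    filter_upwards [self_mem_nhdsWithin] with y hy
    have hy' : 0 < y := hy
    rw [Complex.norm_real, Real.norm_of_nonneg (Real.log_nonneg (by linarith)),
      Real.norm_of_nonneg (by positivity), neg_neg, one_mul]
    simpa using log_one_add_le_rpow_div hy'.le one_pos le_rfl

/-- Integration by parts replaces log(1+y) by 1/(1+y) and y^(s-1) by y^s/s, reducing to the beta
integral at p = 1 + s. The boundary terms vanish exactly because -1 < Re s < 0. -/
theorem mellin_log_one_add {s : ℂ} (h0 : -1 < s.re) (h1 : s.re < 0) :
    mellin (fun y : ℝ => ((Real.log (1 + y) : ℝ) : ℂ)) s = logMellin s := by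
  have hs0 : s ≠ 0 := by rintro rfl; simp at h1
  have hp0 : 0 < (1 + s).re := by simp; linarith
  have hp1 : (1 + s).re < 1 := by simp; linarith
  have hI := integral_cpow_div_one_add hp0 hp1
  rw [show 1 - (1 + s) = -s by ring, show 1 + s - 1 = s by ring] at hI
  have hIint : IntegrableOn (fun y : ℝ => (y : ℂ) ^ s * ((1 / (1 + y) : ℝ) : ℂ)) (Set.Ioi 0) := by
    -- The integral equals a product of nonzero Gamma values, so it cannot be the default value 0.
    by_contra hcon
    rw [integral_undef hcon] at hI
    exact mul_ne_zero (Complex.Gamma_ne_zero_of_re_pos hp0)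
      (Complex.Gamma_ne_zero_of_re_pos (by simpa using h1)) hI.symm
  have hbound : ∀ {ε y : ℝ}, 0 < ε → ε ≤ 1 → 0 < y →
      ‖((Real.log (1 + y) : ℝ) : ℂ) * ((y : ℂ) ^ s / s)‖ ≤ 1 / ε / ‖s‖ * y ^ (s.re + ε) := by
    intro ε y he he1 hy
    have hlog := log_one_add_le_rpow_div hy.le he he1
    rw [← mul_div_assoc, mul_comm, norm_div, norm_ofReal_cpow_mul_ofReal hy _
      (Real.log_nonneg (by linarith)), Real.rpow_add hy]
    have : 0 < ‖s‖ := norm_pos_iff.2 hs0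
    calc y ^ s.re * Real.log (1 + y) / ‖s‖ ≤ y ^ s.re * (y ^ ε / ε) / ‖s‖ := by gcongr
      _ = _ := by ring
  have hparts := integral_Ioi_mul_deriv_eq_deriv_mul (a := 0) (a' := (0 : ℂ)) (b' := 0)
    (u := fun y : ℝ => ((Real.log (1 + y) : ℝ) : ℂ)) (u' := fun y : ℝ => ((1 / (1 + y) : ℝ) : ℂ))
    (v := fun y : ℝ => (y : ℂ) ^ s / s) (v' := fun y : ℝ => (y : ℂ) ^ (s - 1)) ?_ ?_ ?_ ?_ ?_ ?_
  · rw [mellin]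
    simp only [smul_eq_mul]
    simp_rw [mul_comm ((_ : ℂ) ^ (s - 1))]
    rw [hparts, logMellin, mul_comm (Complex.Gamma (-s)), ← hI, ← integral_div, sub_self, zero_sub,
      ← integral_neg]
    refine integral_congr_ae (Eventually.of_forall fun y => ?_)
    simp only
    field_simp
  · intro y hy
    have hy' : 0 < y := hy
    have := ((hasDerivAt_id y).const_add 1).log (by simp only [id]; positivity)
    exact this.ofReal_comp
  · intro y hy
    have hy' : 0 < y := hy
    have := hasDerivAt_ofReal_cpow_const' hy'.ne' (r := s - 1) (by
      intro h; apply hs0; linear_combination h)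
    simpa using this
  · refine (mellinConvergent_log_one_add h0 h1).congr_fun (fun y _ => ?_) measurableSet_Ioi
    simp [mul_comm]
  · refine IntegrableOn.congr_fun (hIint.div_const s) (fun y _ => ?_) measurableSet_Ioi
    simp only [Pi.mul_apply]
    ring
  · refine squeeze_zero_norm' (a := fun y : ℝ => 1 / 1 / ‖s‖ * y ^ (s.re + 1)) ?_ ?_
    · filter_upwards [self_mem_nhdsWithin] with y hy using hbound one_pos le_rfl hy
    · have : Tendsto (fun y : ℝ => y ^ (s.re + 1)) (𝓝 0) (𝓝 (0 ^ (s.re + 1))) :=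
        (Real.continuousAt_rpow_const _ _ (Or.inr (by linarith))).tendsto
      rw [Real.zero_rpow (by linarith)] at this
      simpa using (this.mono_left nhdsWithin_le_nhds).const_mul (1 / 1 / ‖s‖)
  · refine squeeze_zero_norm' (a := fun y : ℝ => 1 / (-(s.re / 2)) / ‖s‖ * y ^ (s.re + -(s.re / 2)))
      ?_ ?_
    · filter_upwards [eventually_gt_atTop 0] with y hy using
        hbound (by linarith) (by linarith) hy
    · have := tendsto_rpow_neg_atTop (y := -(s.re / 2)) (by linarith)
      rw [show s.re + -(s.re / 2) = -(-(s.re / 2)) by ring]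
      simpa using this.const_mul (1 / (-(s.re / 2)) / ‖s‖)

/-! ### Decay on vertical lines, Mellin inversion and Parseval -/

theorem one_add_sq_div_four_le_cosh (b : ℝ) : 1 + b ^ 2 / 4 ≤ Real.cosh b := by
  rw [← Real.cosh_abs, Real.cosh_eq]
  have h1 := Real.quadratic_le_exp_of_nonneg (abs_nonneg b)
  have h2 := Real.add_one_le_exp (-|b|)
  have h3 := sq_abs b
  linarith

theorem abs_sin_mul_cosh_le_norm_sin (a b : ℝ) :
    |Real.sin a| * Real.cosh b ≤ ‖Complex.sin (a + b * Complex.I)‖ := by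
  have h : (Complex.sin (a + b * Complex.I)).re = Real.sin a * Real.cosh b := by
    rw [Complex.sin_add_mul_I, ← Complex.ofReal_sin, ← Complex.ofReal_cosh, ← Complex.ofReal_cos,
      ← Complex.ofReal_sinh, ← Complex.ofReal_mul, ← Complex.ofReal_mul, Complex.add_re,
      Complex.mul_I_re, Complex.ofReal_re, Complex.ofReal_im, neg_zero, add_zero]
  have := Complex.abs_re_le_norm (Complex.sin (a + b * Complex.I))
  rwa [h, abs_mul, abs_of_pos (Real.cosh_pos b)] at this

/-- By reflection, Γ(-s)Γ(1+s) = π / sin(-πs), and the sine grows at least like cosh(πt). The weaker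
quadratic bound on cosh already suffices for integrability. -/
theorem norm_logMellin_le {σ : ℝ} (h0 : -1 < σ) (h1 : σ < 0) (t : ℝ) :
    ‖logMellin (σ + t * Complex.I)‖ ≤
      Real.pi / (Real.sin (Real.pi * -σ) * -σ) * (1 + t ^ 2)⁻¹ := by
  have hsin : 0 < Real.sin (Real.pi * -σ) :=
    Real.sin_pos_of_pos_of_lt_pi (by nlinarith [Real.pi_pos]) (by nlinarith [Real.pi_pos])
  have e : logMellin (σ + t * Complex.I) =
      Real.pi / Complex.sin ((Real.pi * -σ : ℝ) + (-(Real.pi * t) : ℝ) * Complex.I) /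
        (-(σ + t * Complex.I)) := by
    rw [logMellin, show (1 : ℂ) + (σ + t * Complex.I) = 1 - (-(σ + t * Complex.I)) by ring,
      Complex.Gamma_mul_Gamma_one_sub]
    congr 3
    push_cast; ring
  have hs := abs_sin_mul_cosh_le_norm_sin (Real.pi * -σ) (-(Real.pi * t))
  rw [abs_of_pos hsin] at hs
  have hc := one_add_sq_div_four_le_cosh (-(Real.pi * t))
  have hc' : 1 + t ^ 2 ≤ Real.cosh (-(Real.pi * t)) := by
    refine le_trans ?_ hc
    have := Real.pi_gt_three
    nlinarith [mul_nonneg (show (0 : ℝ) ≤ Real.pi ^ 2 - 4 by nlinarith) (sq_nonneg t)]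
  have hre : -σ ≤ ‖(-(σ + t * Complex.I) : ℂ)‖ := by
    have := Complex.re_le_norm (-(σ + t * Complex.I) : ℂ)
    simpa using this
  have hσ : 0 < -σ := by linarith
  have hpi := Real.pi_pos
  rw [e, norm_div, norm_div, Complex.norm_real, Real.norm_of_nonneg hpi.le, div_div]
  calc _ ≤ Real.pi / (Real.sin (Real.pi * -σ) * (1 + t ^ 2) * -σ) := by
        gcongr
        refine le_trans ?_ hs
        gcongr
    _ = _ := by
      have : (0 : ℝ) < 1 + t ^ 2 := by positivity
      field_simp

theorem continuous_logMellin_vertical {σ : ℝ} (h0 : -1 < σ) (h1 : σ < 0) :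
    Continuous fun t : ℝ => logMellin (σ + t * Complex.I) := by
  have hG : ∀ s : ℂ, 0 < s.re → ContinuousAt Complex.Gamma s := fun s hs =>
    (Complex.differentiableAt_Gamma s fun m hm => by
      rw [hm] at hs; simp at hs; linarith [(Nat.cast_nonneg m : (0 : ℝ) ≤ m)]).continuousAt
  rw [continuous_iff_continuousAt]
  intro t
  have hne : -(σ + t * Complex.I : ℂ) ≠ 0 := by
    intro h
    have := congrArg Complex.re h
    simp at this
    linarith
  unfold logMellin
  refine ContinuousAt.div (ContinuousAt.mul ?_ ?_) (by fun_prop) hne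
  · exact ContinuousAt.comp (f := fun t : ℝ => (-(σ + t * Complex.I) : ℂ)) (hG _ (by simpa using h1))
      (by fun_prop)
  · exact ContinuousAt.comp (f := fun t : ℝ => (1 + (σ + t * Complex.I) : ℂ))
      (hG _ (by simp; linarith)) (by fun_prop)

theorem integrable_logMellin_vertical {σ : ℝ} (h0 : -1 < σ) (h1 : σ < 0) :
    Integrable fun t : ℝ => logMellin (σ + t * Complex.I) :=
  Integrable.mono' (integrable_inv_one_add_sq.const_mul _)
    (continuous_logMellin_vertical h0 h1).aestronglyMeasurable
    (Eventually.of_forall (norm_logMellin_le h0 h1))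

theorem log_one_add_eq_mellinInv {σ : ℝ} (h0 : -1 < σ) (h1 : σ < 0) {y : ℝ} (hy : 0 < y) :
    ((Real.log (1 + y) : ℝ) : ℂ) = (1 / (2 * Real.pi) : ℂ) *
      ∫ t : ℝ, (y : ℂ) ^ (-(σ + t * Complex.I)) * logMellin (σ + t * Complex.I) := by
  have hm : ∀ t : ℝ, mellin (fun y : ℝ => ((Real.log (1 + y) : ℝ) : ℂ)) (σ + t * Complex.I) =
      logMellin (σ + t * Complex.I) := fun t =>
    mellin_log_one_add (by simpa using h0) (by simpa using h1)
  have h := mellinInv_mellin_eq σ (fun y : ℝ => ((Real.log (1 + y) : ℝ) : ℂ)) hy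
    (mellinConvergent_log_one_add (by simpa using h0) (by simpa using h1))
    (by
      unfold Complex.VerticalIntegrable
      simp_rw [hm]
      exact integrable_logMellin_vertical h0 h1)
    (by
      have : 1 + y ≠ 0 := by positivity
      fun_prop (disch := assumption))
  rw [← h, mellinInv]
  simp_rw [hm, smul_eq_mul]
  rw [Complex.real_smul]
  push_cast
  rfl

/-- Parseval's formula for the Mellin transform, paired with `u ↦ log (1 + x u)`. -/
theorem integral_log_one_add_mul_eq {k : ℝ → ℝ} (hk : Measurable k) {σ x : ℝ} (h0 : -1 < σ)
    (h1 : σ < 0) (hx : 0 < x)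
    (hkint : IntegrableOn (fun u => u ^ (-σ) * k u) (Set.Ioi 0)) :
    Integrable (fun t : ℝ => logMellin (σ + t * Complex.I) * (x : ℂ) ^ (-(σ + t * Complex.I)) *
        ∫ u in Set.Ioi (0 : ℝ), (u : ℂ) ^ (-(σ + t * Complex.I)) * (k u : ℂ)) ∧
      ((∫ u in Set.Ioi (0 : ℝ), Real.log (1 + x * u) * k u : ℝ) : ℂ) =
        (1 / (2 * Real.pi) : ℂ) *
          ∫ t : ℝ, logMellin (σ + t * Complex.I) * (x : ℂ) ^ (-(σ + t * Complex.I)) *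
            ∫ u in Set.Ioi (0 : ℝ), (u : ℂ) ^ (-(σ + t * Complex.I)) * (k u : ℂ) := by
  set ν : Measure ℝ := volume.restrict (Set.Ioi 0) with hν
  set F : ℝ → ℝ → ℂ := fun u t => logMellin (σ + t * Complex.I) *
    ((x : ℂ) ^ (-(σ + t * Complex.I)) * ((u : ℂ) ^ (-(σ + t * Complex.I)) * (k u : ℂ))) with hF
  have hmeas : Measurable (Function.uncurry F) := by
    have h2 : Measurable fun q : ℝ × ℝ => logMellin (σ + q.2 * Complex.I) :=
      (continuous_logMellin_vertical h0 h1).measurable.comp measurable_snd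
    simp only [hF, Function.uncurry_def]
    fun_prop
  have hFint : Integrable (Function.uncurry F) (ν.prod volume) := by
    -- On the line Re s = σ the norm of the integrand is a product of a function of u and a function
    -- of t, so Fubini needs only the two separate integrabilities.
    have hdom := (Integrable.norm hkint).mul_prod
      ((integrable_logMellin_vertical h0 h1).norm.const_mul (x ^ (-σ)))
    refine Integrable.mono' hdom hmeas.aestronglyMeasurable ?_
    have hae : ∀ᵐ q : ℝ × ℝ ∂(ν.prod volume), 0 < q.1 :=
      Measure.quasiMeasurePreserving_fst.ae (ae_restrict_mem measurableSet_Ioi)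
    filter_upwards [hae] with q hq
    have hre : (-(σ + q.2 * Complex.I) : ℂ).re = -σ := by simp
    simp only [hF, Function.uncurry_def]
    rw [norm_mul, norm_mul, norm_mul, Complex.norm_cpow_eq_rpow_re_of_pos hx,
      Complex.norm_cpow_eq_rpow_re_of_pos hq, hre, Complex.norm_real, norm_mul,
      Real.norm_of_nonneg (Real.rpow_nonneg hq.le (-σ))]
    exact le_of_eq (by ring)
  have hinner : ∀ t : ℝ, ∫ u, F u t ∂ν =
      logMellin (σ + t * Complex.I) * (x : ℂ) ^ (-(σ + t * Complex.I)) *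
        ∫ u, (u : ℂ) ^ (-(σ + t * Complex.I)) * (k u : ℂ) ∂ν := by
    intro t
    simp only [hF]
    rw [integral_const_mul, integral_const_mul, mul_assoc]
  simp_rw [← hinner]
  refine ⟨hFint.integral_prod_right, ?_⟩
  rw [← integral_integral_swap hFint, ← integral_complex_ofReal, ← integral_const_mul]
  refine integral_congr_ae ?_
  filter_upwards [ae_restrict_mem measurableSet_Ioi] with u hu
  have hu' : 0 < u := hu
  rw [Complex.ofReal_mul, log_one_add_eq_mellinInv h0 h1 (mul_pos hx hu'), mul_assoc,
    ← integral_mul_const]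
  congr 2
  ext t
  rw [Complex.ofReal_mul, Complex.mul_cpow_ofReal_nonneg hx.le hu'.le]
  ring

/-! ### The G-function as a logarithmic integral -/

/-- The substitution v = u^p turns this into Euler's integral for Γ(s/p). -/
theorem integral_cpow_mul_exp_neg_mul_rpow {p l : ℝ} (hp : 0 < p) (hl : 0 < l) {s : ℂ}
    (hs : 0 < s.re) :
    ∫ u in Set.Ioi (0 : ℝ), (u : ℂ) ^ (s - 1) * ((Real.exp (-(l * u ^ p)) : ℝ) : ℂ) =
      1 / p * ((l : ℂ) ^ (-(s / p)) * Complex.Gamma (s / p)) := by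
  have h := mellin_comp_rpow (fun v : ℝ => ((Real.exp (-(l * v)) : ℝ) : ℂ)) s p
  have hre : 0 < (s / p).re := by rw [Complex.div_ofReal_re]; positivity
  have h2 := Complex.integral_cpow_mul_exp_neg_mul_Ioi hre hl
  rw [mellin, mellin, abs_of_pos hp] at h
  simp only [smul_eq_mul] at h
  rw [one_div (l : ℂ)] at h2
  rw [h, Complex.real_smul, one_div, Complex.cpow_neg, ← Complex.inv_cpow _ _ (by
    rw [Complex.arg_ofReal_of_nonneg hl.le]; exact Real.pi_pos.ne), ← h2]
  push_cast
  simp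

/-- The integral `∫₀^∞ log (1 + x u) u ^ (αM/2 - 1) exp (-l u ^ (α/2)) du`. -/
def logGammaIntegral (α M : ℕ) (x l : ℝ) : ℝ :=
  ∫ u in Set.Ioi (0 : ℝ), Real.log (1 + x * u) *
    (u ^ ((α : ℝ) * M / 2 - 1) * Real.exp (-(l * u ^ ((α : ℝ) / 2))))

/-- The binding poles are the smallest entry -M/2 of the lower list (j = 0) and the largest entry of
the first upper list (j = α - 1). They leave an open window of width 1/α. -/
theorem meijerGSeparates_iff {α : ℕ} (hα : 0 < α) {M : ℕ} (hM : 0 < M) (c : ℝ) :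
    MeijerGSeparates (2 + 2 * α) α (upperParams α M) (lowerParams α M) c ↔
      c < -(M / 2) ∧ -(M / 2) - 1 / α < c := by
  have hα' : (0 : ℝ) < α := by exact_mod_cast hα
  have hM' : (0 : ℝ) < M := by exact_mod_cast hM
  rw [MeijerGSeparates, take_lowerParams, take_upperParams]
  have hmem : ∀ (k : ℕ) (y b : ℂ), b ∈ deltaList k y ↔ ∃ j < k, b = (y + j) / k := by
    intro k y b
    simp [deltaList, eq_comm]
  have hre : ∀ j : ℕ, ((-((α : ℂ) * M / 2) + j) / α).re = -(M / 2) + j / α := by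
    intro j
    rw [Complex.div_natCast_re, show (-((α : ℂ) * M / 2) + j) = ((-(α * M / 2) + j : ℝ) : ℂ) by
      push_cast; ring, Complex.ofReal_re]
    field_simp
  constructor
  · rintro ⟨h1, h2⟩
    have h3 := h1 ((-((α : ℂ) * M / 2) + (0 : ℕ)) / α) (by
      simp only [lowerParams, List.mem_append, hmem]
      exact Or.inr ⟨0, hα, rfl⟩)
    have h4 := h2 ((-((α : ℂ) * M / 2) + (α - 1 : ℕ)) / α) (by
      rw [hmem]; exact ⟨α - 1, by omega, rfl⟩)
    rw [hre] at h3 h4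
    refine ⟨by simpa using h3, ?_⟩
    rw [Nat.cast_sub hα, Nat.cast_one, sub_div, div_self hα'.ne'] at h4
    linarith
  · rintro ⟨h1, h2⟩
    refine ⟨?_, ?_⟩
    · intro b hb
      simp only [lowerParams, List.mem_append, hmem] at hb
      rcases hb with (⟨j, hj, rfl⟩ | ⟨j, hj, rfl⟩) | ⟨j, hj, rfl⟩
      · have : ((0 + (j : ℂ)) / (2 : ℕ)).re = j / 2 := by
          rw [Complex.div_natCast_re]; simp
        rw [this]
        have : (0 : ℝ) ≤ j / 2 := by positivity
        linarith
      all_goals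
        rw [hre]
        have : (0 : ℝ) ≤ j / α := by positivity
        linarith
    · intro b hb
      rw [hmem] at hb
      obtain ⟨j, hj, rfl⟩ := hb
      rw [hre]
      have : (j : ℝ) / α ≤ (α - 1) / α := by
        gcongr
        have : (j : ℝ) + 1 ≤ α := by exact_mod_cast hj
        linarith
      rw [sub_div, div_self hα'.ne'] at this
      linarith

theorem meijerG_line_eq {α M : ℕ} (hα : 0 < α) (hM : 0 < M) {x l : ℝ} (hx : 0 < x) (hl : 0 < l)
    {c : ℝ} (hc : MeijerGSeparates (2 + 2 * α) α (upperParams α M) (lowerParams α M) c) :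
    Integrable (fun t : ℝ => meijerGIntegrand (2 + 2 * α) α (upperParams α M) (lowerParams α M)
        ((1 / x ^ α * (l / 2) ^ 2 : ℝ) : ℂ) (c + t * Complex.I)) ∧
      meijerGLine (2 + 2 * α) α (upperParams α M) (lowerParams α M)
        ((1 / x ^ α * (l / 2) ^ 2 : ℝ) : ℂ) c =
        ((√Real.pi * α * (2 * Real.pi) ^ (α - 1) * x ^ ((α : ℝ) * M / 2) *
          logGammaIntegral α M x l : ℝ) : ℂ) := by
  have hα' : (0 : ℝ) < α := by exact_mod_cast hα
  have hαc : (α : ℂ) ≠ 0 := by exact_mod_cast hα.ne'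
  have hM' : (0 : ℝ) < M := by exact_mod_cast hM
  obtain ⟨hc1, hc2⟩ := (meijerGSeparates_iff hα hM c).1 hc
  -- From -w = αM/2 + αs: this affine map carries the window of separating c onto the strip -1 < σ <
  -- 0 and rescales the ordinate t by α.
  set σ : ℝ := α * M / 2 + α * c with hσ
  have h1 : σ < 0 := by
    rw [hσ]; nlinarith
  have h0 : -1 < σ := by
    have : α * (-(M / 2) - 1 / α) < α * c := by gcongr
    rw [mul_sub, mul_one_div_cancel hα'.ne'] at this
    rw [hσ]; linarith
  set A : ℝ := α * M / 2 with hA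
  have hApos : 0 < A := by positivity
  set k : ℝ → ℝ := fun u => u ^ (A - 1) * Real.exp (-(l * u ^ ((α : ℝ) / 2))) with hk
  have hkm : Measurable k := by fun_prop
  have hkint : IntegrableOn (fun u => u ^ (-σ) * k u) (Set.Ioi 0) := by
    refine IntegrableOn.congr_fun (integrableOn_rpow_mul_exp_neg_mul_rpow_of_pos
      (p := (α : ℝ) / 2) (q := -σ + (A - 1)) (by positivity) (by linarith) hl) (fun u hu => ?_)
      measurableSet_Ioi
    simp only [hk]
    rw [Real.rpow_add hu, neg_mul, mul_assoc]
  obtain ⟨hI, hE⟩ := integral_log_one_add_mul_eq hkm h0 h1 hx hkint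
  have hin : ∀ t : ℝ, ∫ u in Set.Ioi (0 : ℝ), (u : ℂ) ^ (-(σ + t * Complex.I)) * (k u : ℂ) =
      1 / ((α / 2 : ℝ) : ℂ) * ((l : ℂ) ^ (-((A - (σ + t * Complex.I)) / ((α / 2 : ℝ) : ℂ))) *
        Complex.Gamma ((A - (σ + t * Complex.I)) / ((α / 2 : ℝ) : ℂ))) := by
    intro t
    rw [← integral_cpow_mul_exp_neg_mul_rpow (by positivity) hl (by simp; linarith)]
    refine setIntegral_congr_fun measurableSet_Ioi fun u hu => ?_
    have hu' : 0 < u := hu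
    simp only [hk]
    rw [Complex.ofReal_mul, Complex.ofReal_cpow hu'.le, ← mul_assoc, ← Complex.cpow_add _ _
      (by exact_mod_cast hu'.ne')]
    congr 2
    push_cast; ring
  set h : ℝ → ℂ := fun t => logMellin (σ + t * Complex.I) * (x : ℂ) ^ (-(σ + t * Complex.I)) *
    ∫ u in Set.Ioi (0 : ℝ), (u : ℂ) ^ (-(σ + t * Complex.I)) * (k u : ℂ) with hh
  -- One factor α comes from `meijerGIntegrand_eq`, the other offsets the 2/α in the transform of
  -- the kernel; rescaling t then removes one of the two.
  set K : ℂ := √Real.pi * α ^ 2 * (2 * Real.pi) ^ (α - 1) * (x : ℂ) ^ (A : ℂ) with hK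
  have hpt : ∀ t : ℝ, meijerGIntegrand (2 + 2 * α) α (upperParams α M) (lowerParams α M)
        ((1 / x ^ α * (l / 2) ^ 2 : ℝ) : ℂ) (c + t * Complex.I) = K * h (α * t) := by
    intro t
    have hw : -(σ + ((α * t : ℝ) : ℂ) * Complex.I) =
        -((α : ℂ) * M / 2) - α * (c + t * Complex.I) := by
      rw [hσ, hA]; push_cast; ring
    rw [meijerGIntegrand_eq M hα hx hl hw (by simpa using h1)]
    simp only [hh, hin]
    have e1 : (A - (σ + ((α * t : ℝ) : ℂ) * Complex.I)) / ((α / 2 : ℝ) : ℂ) =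
        -2 * (c + t * Complex.I) := by
      rw [hσ, hA]; push_cast; field_simp; ring
    rw [e1, neg_neg, Complex.cpow_add _ _ (by exact_mod_cast hx.ne'), hK]
    have e2 : (α * M / 2 : ℂ) = (A : ℂ) := by rw [hA]; push_cast; ring
    rw [e2]
    push_cast
    rw [neg_mul, neg_neg]
    field_simp
  simp_rw [meijerGLine, hpt]
  refine ⟨(hI.comp_mul_left' hα'.ne').const_mul K, ?_⟩
  rw [integral_const_mul, Measure.integral_comp_mul_left, abs_of_pos (inv_pos.2 hα'),
    Complex.real_smul]
  have hE' : (logGammaIntegral α M x l : ℂ) = 1 / (2 * Real.pi) * ∫ t, h t := hE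
  rw [Complex.ofReal_mul, hE', hK, Complex.ofReal_mul, Complex.ofReal_cpow hx.le]
  push_cast
  field_simp

theorem meijerG_wellDefined {α M : ℕ} (hα : 0 < α) (hM : 0 < M) {x l : ℝ} (hx : 0 < x)
    (hl : 0 < l) :
    MeijerGWellDefined (2 + 2 * α) α (upperParams α M) (lowerParams α M)
        ((1 / x ^ α * (l / 2) ^ 2 : ℝ) : ℂ) ∧
      meijerG (2 + 2 * α) α (upperParams α M) (lowerParams α M)
        ((1 / x ^ α * (l / 2) ^ 2 : ℝ) : ℂ) =
        ((√Real.pi * α * (2 * Real.pi) ^ (α - 1) * x ^ ((α : ℝ) * M / 2) *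
          logGammaIntegral α M x l : ℝ) : ℂ) := by
  have hα' : (0 : ℝ) < α := by exact_mod_cast hα
  have hex : ∃ c : ℝ, MeijerGSeparates (2 + 2 * α) α (upperParams α M) (lowerParams α M) c := by
    refine ⟨-(M / 2) - 1 / (2 * α), (meijerGSeparates_iff hα hM _).2 ⟨?_, ?_⟩⟩
    · have : (0 : ℝ) < 1 / (2 * α) := by positivity
      linarith
    · have : (1 : ℝ) / (2 * α) < 1 / α := by
        apply one_div_lt_one_div_of_lt hα'; linarith
      linarith
  have hval : meijerG (2 + 2 * α) α (upperParams α M) (lowerParams α M)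
        ((1 / x ^ α * (l / 2) ^ 2 : ℝ) : ℂ) =
        ((√Real.pi * α * (2 * Real.pi) ^ (α - 1) * x ^ ((α : ℝ) * M / 2) *
          logGammaIntegral α M x l : ℝ) : ℂ) := by
    -- The chosen line is unknown, but the value found on a separating line does not involve c.
    rw [meijerG, dif_pos hex]
    exact (meijerG_line_eq hα hM hx hl hex.choose_spec).2
  refine ⟨⟨hex, fun c hc => ?_⟩, hval⟩
  rw [hval]
  exact meijerG_line_eq hα hM hx hl hc

/-! ### Jensen's inequality and the limit of small exponent -/

section ExponentialMeans

variable {S : Type*} [MeasurableSpace S] {P : Measure S} [IsProbabilityMeasure P] {Y : S → ℝ}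

theorem integrable_exp_neg_mul_of_nonneg (hY : Integrable Y P) (h0 : ∀ ω, 0 ≤ Y ω) {ν : ℝ}
    (hν : 0 ≤ ν) : Integrable (fun ω => Real.exp (-ν * Y ω)) P := by
  refine Integrable.mono' (integrable_const 1) ?_ (Eventually.of_forall fun ω => ?_)
  · exact Real.continuous_exp.comp_aestronglyMeasurable (hY.1.const_mul (-ν))
  · rw [Real.norm_of_nonneg (Real.exp_pos _).le, Real.exp_le_one_iff]
    nlinarith [h0 ω]

/-- Jensen's inequality for the logarithm. -/
theorem neg_log_integral_exp_le (hY : Integrable Y P) (h0 : ∀ ω, 0 ≤ Y ω) {ν : ℝ} (hν : 0 ≤ ν) :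
    -Real.log (∫ ω, Real.exp (-ν * Y ω) ∂P) ≤ ν * ∫ ω, Y ω ∂P := by
  have hint := integrable_exp_neg_mul_of_nonneg hY h0 hν
  have hpos : 0 < ∫ ω, Real.exp (-ν * Y ω) ∂P := integral_exp_pos hint
  set c := ∫ ω, Real.exp (-ν * Y ω) ∂P with hc
  -- Tangent-line form of Jensen: log z ≤ z - 1 at z = e^(-νY)/c, integrated; the mean of z is 1.
  have h1 : ∫ ω, -ν * Y ω ∂P ≤ ∫ ω, (Real.log c - 1 + Real.exp (-ν * Y ω) / c) ∂P := by
    refine integral_mono (hY.const_mul _) ((integrable_const _).add (hint.div_const c)) fun ω => ?_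
    have h2 := Real.log_le_sub_one_of_pos (div_pos (Real.exp_pos (-ν * Y ω)) hpos)
    rw [Real.log_div (Real.exp_pos _).ne' hpos.ne', Real.log_exp] at h2
    simp only
    linarith
  rw [integral_const_mul, integral_add (integrable_const _) (hint.div_const c), integral_div, ← hc,
    div_self hpos.ne', integral_const, probReal_univ, one_smul] at h1
  linarith

/-- Squeeze: -log c ≥ 1 - c bounds the expression below by E[(1 - e^(-νY))/ν], and Jensen bounds it
above by E[Y]. The lower bound converges by dominated convergence with dominating function Y. -/
theorem tendsto_neg_log_integral_exp_div (hY : Integrable Y P) (h0 : ∀ ω, 0 ≤ Y ω) :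
    Tendsto (fun ν : ℝ => -(1 / ν) * Real.log (∫ ω, Real.exp (-ν * Y ω) ∂P)) (𝓝[>] 0)
      (𝓝 (∫ ω, Y ω ∂P)) := by
  have hlow : Tendsto (fun ν : ℝ => ∫ ω, (1 - Real.exp (-ν * Y ω)) / ν ∂P) (𝓝[>] 0)
      (𝓝 (∫ ω, Y ω ∂P)) := by
    refine tendsto_integral_filter_of_dominated_convergence Y ?_ ?_ hY ?_
    · refine Eventually.of_forall fun ν => ?_
      have : AEStronglyMeasurable (fun ω => Real.exp (-ν * Y ω)) P :=
        Real.continuous_exp.comp_aestronglyMeasurable (hY.1.const_mul (-ν))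
      exact (aestronglyMeasurable_const.sub this).mul_const ν⁻¹
    · filter_upwards [self_mem_nhdsWithin] with ν hν
      have hν' : 0 < ν := hν
      refine Eventually.of_forall fun ω => ?_
      have h1 : Real.exp (-ν * Y ω) ≤ 1 := by
        rw [Real.exp_le_one_iff]; nlinarith [h0 ω]
      have h2 := Real.add_one_le_exp (-ν * Y ω)
      rw [Real.norm_of_nonneg (div_nonneg (by linarith) hν'.le), div_le_iff₀ hν']
      linarith
    · refine Eventually.of_forall fun ω => ?_
      -- The pointwise limit is the derivative at ν = 0.
      have hd : HasDerivAt (fun ν : ℝ => 1 - Real.exp (-ν * Y ω)) (Y ω) 0 := by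
        have := (((hasDerivAt_id (0 : ℝ)).neg.mul_const (Y ω)).exp).const_sub 1
        simpa using this
      have := (hasDerivAt_iff_tendsto_slope_zero.1 hd).mono_left
        (nhdsWithin_mono 0 fun x (hx : 0 < x) => hx.ne')
      refine this.congr fun ν => ?_
      simp [div_eq_inv_mul]
  refine tendsto_of_tendsto_of_tendsto_of_le_of_le' hlow tendsto_const_nhds ?_ ?_
  · filter_upwards [self_mem_nhdsWithin] with ν hν
    have hν' : 0 < ν := hν
    have hint := integrable_exp_neg_mul_of_nonneg hY h0 hν'.le
    rw [integral_div, integral_sub (integrable_const _) hint, integral_const, probReal_univ,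
      one_smul]
    have := Real.log_le_sub_one_of_pos (integral_exp_pos hint)
    rw [neg_mul, div_mul_eq_mul_div, one_mul, ← neg_div]
    gcongr
    linarith
  · filter_upwards [self_mem_nhdsWithin] with ν hν
    have hν' : 0 < ν := hν
    have := neg_log_integral_exp_le hY h0 hν'.le
    rw [neg_mul, div_mul_eq_mul_div, one_mul, ← neg_div, div_le_iff₀ hν']
    linarith

end ExponentialMeans

theorem ergodicRate_eq_integral_log_div {S : Type*} [MeasurableSpace S] {P : Measure S}
    {a : NOMAUser → ℝ} {ρ : ℝ} {h : NOMAUser → S → ℂ} {i : NOMAUser} :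
    ergodicRate P a ρ h i = (∫ ω, Real.log (1 + sinr a ρ h i ω) ∂P) / Real.log 2 := by
  rw [← integral_div]; rfl

theorem rpow_eq_exp_neg_mul_log {S : Type*} {a : NOMAUser → ℝ} {ρ : ℝ} {h : NOMAUser → S → ℂ}
    {i : NOMAUser} (h0 : ∀ ω, 0 ≤ sinr a ρ h i ω) (ν : ℝ) (ω : S) :
    (1 + sinr a ρ h i ω) ^ (-ν) = Real.exp (-ν * Real.log (1 + sinr a ρ h i ω)) := by
  rw [Real.rpow_def_of_pos (by linarith [h0 ω]), mul_comm]

theorem qosNu_pos {θ T B : ℝ} (hθ : 0 < θ) (hT : 0 < T) (hB : 0 < B) : 0 < qosNu θ T B := by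
  have := Real.log_pos one_lt_two
  unfold qosNu; positivity

section Rates

variable {S : Type*} [MeasurableSpace S] {P : Measure S} [IsProbabilityMeasure P]
  {a : NOMAUser → ℝ} {ρ : ℝ} {h : NOMAUser → S → ℂ} {i : NOMAUser}

theorem effectiveRate_bounds (h0 : ∀ ω, 0 ≤ sinr a ρ h i ω)
    (hint : Integrable (fun ω => Real.log (1 + sinr a ρ h i ω)) P) {T B : ℝ} (hT : 0 < T)
    (hB : 0 < B) :
    Integrable (fun ω => Real.logb 2 (1 + sinr a ρ h i ω)) P ∧
      (∀ θ : ℝ, 0 < θ →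
        Integrable (fun ω => (1 + sinr a ρ h i ω) ^ (-qosNu θ T B)) P ∧
        effectiveRate P a ρ T B h i θ ≤
          -(1 / qosNu θ T B) *
            ∫ ω, Real.logb 2 ((1 + sinr a ρ h i ω) ^ (-qosNu θ T B)) ∂P ∧
        -(1 / qosNu θ T B) *
            ∫ ω, Real.logb 2 ((1 + sinr a ρ h i ω) ^ (-qosNu θ T B)) ∂P =
          ergodicRate P a ρ h i ∧
        effectiveRate P a ρ T B h i θ ≤ ergodicRate P a ρ h i) ∧
      Tendsto (fun θ : ℝ => effectiveRate P a ρ T B h i θ) (𝓝[>] 0)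
        (𝓝 (ergodicRate P a ρ h i)) := by
  have hl2 : 0 < Real.log 2 := Real.log_pos one_lt_two
  have hY0 : ∀ ω, 0 ≤ Real.log (1 + sinr a ρ h i ω) := fun ω =>
    Real.log_nonneg (by linarith [h0 ω])
  have heff : ∀ θ, effectiveRate P a ρ T B h i θ = -(1 / qosNu θ T B) *
      Real.log (∫ ω, Real.exp (-qosNu θ T B * Real.log (1 + sinr a ρ h i ω)) ∂P) /
        Real.log 2 := by
    intro θ
    simp_rw [effectiveRate, rpow_eq_exp_neg_mul_log h0, Real.logb, mul_div_assoc]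
  refine ⟨hint.div_const _, fun θ hθ => ?_, ?_⟩
  · have hν := qosNu_pos hθ hT hB
    have hmean : -(1 / qosNu θ T B) *
          ∫ ω, Real.logb 2 ((1 + sinr a ρ h i ω) ^ (-qosNu θ T B)) ∂P =
        ergodicRate P a ρ h i := by
      rw [ergodicRate, ← integral_const_mul]
      refine integral_congr_ae (Eventually.of_forall fun ω => ?_)
      simp only
      rw [Real.logb_rpow_eq_mul_logb_of_pos (by linarith [h0 ω])]
      field_simp
    have hle : effectiveRate P a ρ T B h i θ ≤ ergodicRate P a ρ h i := by
      rw [heff, ergodicRate_eq_integral_log_div]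
      gcongr
      have := neg_log_integral_exp_le hint hY0 hν.le
      rw [neg_mul, div_mul_eq_mul_div, one_mul, ← neg_div, div_le_iff₀ hν]
      linarith
    refine ⟨?_, hmean.symm ▸ hle, hmean, hle⟩
    simp_rw [rpow_eq_exp_neg_mul_log h0]
    exact integrable_exp_neg_mul_of_nonneg hint hY0 hν.le
  · simp_rw [heff]
    rw [ergodicRate_eq_integral_log_div]
    refine Tendsto.div_const ?_ _
    refine (tendsto_neg_log_integral_exp_div hint hY0).comp ?_
    refine tendsto_nhdsWithin_iff.2 ⟨?_, ?_⟩
    · have hc : Continuous fun θ : ℝ => qosNu θ T B := by unfold qosNu; fun_prop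
      have := hc.tendsto 0
      rw [show qosNu 0 T B = 0 by simp [qosNu]] at this
      exact this.mono_left nhdsWithin_le_nhds
    · filter_upwards [self_mem_nhdsWithin] with θ hθ using qosNu_pos hθ hT hB

end Rates

/-! ### The α-μ gain law and its tail -/

/-- The normalising constant of the gain density. -/
def alphaMuGainConst (α μ : ℕ) (Ω : ℝ) : ℝ :=
  (α : ℝ) * (μ : ℝ) ^ μ / (2 * Ω ^ (α * μ) * Real.Gamma (μ : ℝ))

/-- The complementary distribution function of the gain. -/
def alphaMuGainTail (α μ : ℕ) (Ω u : ℝ) : ℝ :=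
  Real.exp (-(μ / Ω ^ α * u ^ ((α : ℝ) / 2))) *
    ∑ m ∈ Finset.range μ, (μ / Ω ^ α * u ^ ((α : ℝ) / 2)) ^ m / (m.factorial : ℝ)

section Law

variable {α μ : ℕ} {Ω : ℝ}

theorem alphaMuGainPDF_of_pos {x : ℝ} (hx : 0 < x) :
    alphaMuGainPDF α μ Ω x = alphaMuGainConst α μ Ω *
      (x ^ ((α : ℝ) * μ / 2 - 1) * Real.exp (-(μ / Ω ^ α * x ^ ((α : ℝ) / 2)))) := by
  rw [alphaMuGainPDF, if_pos hx, alphaMuGainConst, mul_div_right_comm, div_mul_eq_mul_div (μ : ℝ),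
    mul_assoc]

theorem measurable_alphaMuGainPDF : Measurable (alphaMuGainPDF α μ Ω) := by
  unfold alphaMuGainPDF
  exact Measurable.ite measurableSet_Ioi (by fun_prop) measurable_const

theorem alphaMuGainConst_nonneg (hΩ : 0 < Ω) : 0 ≤ alphaMuGainConst α μ Ω := by
  have : 0 ≤ Real.Gamma μ := Real.Gamma_nonneg_of_nonneg (Nat.cast_nonneg μ)
  unfold alphaMuGainConst; positivity

theorem alphaMuGainPDF_nonneg (hΩ : 0 < Ω) (x : ℝ) : 0 ≤ alphaMuGainPDF α μ Ω x := by
  rcases lt_or_ge 0 x with hx | hx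
  · rw [alphaMuGainPDF_of_pos hx]
    exact mul_nonneg (alphaMuGainConst_nonneg hΩ) (by positivity)
  · rw [alphaMuGainPDF, if_neg hx.not_gt]

theorem alphaMuGainPDF_mul_eq_indicator (F : ℝ → ℝ) :
    (fun x => alphaMuGainPDF α μ Ω x * F x) =
      (Set.Ioi 0).indicator fun x => alphaMuGainPDF α μ Ω x * F x := by
  ext x
  rcases lt_or_ge 0 x with hx | hx
  · rw [Set.indicator_of_mem (show x ∈ Set.Ioi 0 from hx)]
  · rw [Set.indicator_of_notMem (show x ∉ Set.Ioi 0 from hx.not_gt), alphaMuGainPDF,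
      if_neg hx.not_gt, zero_mul]

theorem integral_alphaMuGainLaw (hΩ : 0 < Ω) (F : ℝ → ℝ) :
    ∫ x, F x ∂(alphaMuGainLaw α μ Ω) =
      ∫ x in Set.Ioi (0 : ℝ), alphaMuGainPDF α μ Ω x * F x := by
  rw [alphaMuGainLaw, integral_withDensity_eq_integral_toReal_smul
    measurable_alphaMuGainPDF.ennreal_ofReal (by simp)]
  simp_rw [ENNReal.toReal_ofReal (alphaMuGainPDF_nonneg hΩ _), smul_eq_mul]
  conv_lhs => rw [alphaMuGainPDF_mul_eq_indicator, integral_indicator measurableSet_Ioi]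

theorem integrable_alphaMuGainLaw_iff (hΩ : 0 < Ω) (F : ℝ → ℝ) :
    Integrable F (alphaMuGainLaw α μ Ω) ↔
      IntegrableOn (fun x => alphaMuGainPDF α μ Ω x * F x) (Set.Ioi 0) := by
  rw [alphaMuGainLaw, integrable_withDensity_iff_integrable_smul'
    measurable_alphaMuGainPDF.ennreal_ofReal (by simp)]
  simp_rw [ENNReal.toReal_ofReal (alphaMuGainPDF_nonneg hΩ _), smul_eq_mul]
  conv_lhs => rw [alphaMuGainPDF_mul_eq_indicator, integrable_indicator_iff measurableSet_Ioi]

theorem integrableOn_log_one_add_mul {A p x l : ℝ} (hA : 0 < A) (hp : 0 < p) (hx : 0 < x)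
    (hl : 0 < l) :
    IntegrableOn (fun u : ℝ => Real.log (1 + x * u) * (u ^ (A - 1) * Real.exp (-(l * u ^ p))))
      (Set.Ioi 0) := by
  have h1 := (integrableOn_rpow_mul_exp_neg_mul_rpow_of_pos (p := p) (q := A) hp (by linarith)
    hl).const_mul x
  refine Integrable.mono' h1 (Measurable.aestronglyMeasurable (by fun_prop)) ?_
  filter_upwards [ae_restrict_mem measurableSet_Ioi] with u hu
  have hu' : 0 < u := hu
  have hxu : 0 < x * u := by positivity
  have h2 := Real.log_le_sub_one_of_pos (show 0 < 1 + x * u by linarith)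
  have h3 := Real.log_nonneg (show 1 ≤ 1 + x * u by linarith)
  rw [Real.norm_of_nonneg (by positivity)]
  calc _ ≤ (x * u) * (u ^ (A - 1) * Real.exp (-(l * u ^ p))) := by gcongr; linarith
    _ = _ := by
      rw [Real.rpow_sub_one hu'.ne', neg_mul]
      field_simp

theorem integrable_log_one_add_mul_alphaMuGainLaw (hα : 0 < α) (hμ : 0 < μ) (hΩ : 0 < Ω) {x : ℝ}
    (hx : 0 < x) :
    Integrable (fun u => Real.log (1 + x * u)) (alphaMuGainLaw α μ Ω) := by
  have hα' : (0 : ℝ) < α := by exact_mod_cast hα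
  have hμ' : (0 : ℝ) < μ := by exact_mod_cast hμ
  rw [integrable_alphaMuGainLaw_iff hΩ]
  refine IntegrableOn.congr_fun ((integrableOn_log_one_add_mul (A := (α : ℝ) * μ / 2)
    (p := (α : ℝ) / 2) (l := μ / Ω ^ α) (by positivity) (by positivity) hx
    (by positivity)).const_mul (alphaMuGainConst α μ Ω)) (fun u hu => ?_) measurableSet_Ioi
  rw [alphaMuGainPDF_of_pos hu]
  ring

theorem integral_log_one_add_mul_alphaMuGainLaw (hΩ : 0 < Ω) (x : ℝ) :
    ∫ u, Real.log (1 + x * u) ∂(alphaMuGainLaw α μ Ω) =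
      alphaMuGainConst α μ Ω * logGammaIntegral α μ x (μ / Ω ^ α) := by
  rw [integral_alphaMuGainLaw hΩ, logGammaIntegral, ← integral_const_mul]
  refine setIntegral_congr_fun measurableSet_Ioi fun u hu => ?_
  rw [alphaMuGainPDF_of_pos hu]
  ring

/-- The derivative telescopes: each new term of the sum cancels the previous remainder, so only the
top term survives. -/
theorem hasDerivAt_exp_neg_mul_sum (n : ℕ) (v : ℝ) :
    HasDerivAt (fun v : ℝ => Real.exp (-v) *
        ∑ m ∈ Finset.range (n + 1), v ^ m / (m.factorial : ℝ))
      (-(Real.exp (-v) * (v ^ n / (n.factorial : ℝ)))) v := by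
  induction n with
  | zero => simpa using (hasDerivAt_neg v).exp
  | succ n ih =>
    have h1 : HasDerivAt (fun v : ℝ => Real.exp (-v) * (v ^ (n + 1) / ((n + 1).factorial : ℝ)))
        (-Real.exp (-v) * (v ^ (n + 1) / ((n + 1).factorial : ℝ)) +
          Real.exp (-v) * ((n + 1 : ℕ) * v ^ n / ((n + 1).factorial : ℝ))) v := by
      have h2 := (hasDerivAt_neg v).exp
      have h3 := (hasDerivAt_pow (n + 1) v).div_const ((n + 1).factorial : ℝ)
      refine (h2.mul h3).congr_deriv ?_
      simp
    have h4 := ih.add h1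
    have hf : ((n + 1).factorial : ℝ) = (n + 1) * n.factorial := by
      rw [Nat.factorial_succ]; push_cast; ring
    have hn : (n.factorial : ℝ) ≠ 0 := by exact_mod_cast n.factorial_ne_zero
    have hn1 : (n : ℝ) + 1 ≠ 0 := by positivity
    refine (h4.congr_deriv ?_).congr_of_eventuallyEq (Eventually.of_forall fun y => ?_)
    · rw [hf]; push_cast; field_simp; ring
    · simp only [Pi.add_apply]
      rw [Finset.sum_range_succ, mul_add]

theorem hasDerivAt_alphaMuGainTail (hμ : 0 < μ) (hΩ : 0 < Ω) {u : ℝ} (hu : 0 < u) :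
    HasDerivAt (fun u => -alphaMuGainTail α μ Ω u) (alphaMuGainPDF α μ Ω u) u := by
  obtain ⟨n, rfl⟩ : ∃ n, μ = n + 1 := ⟨μ - 1, by omega⟩
  set l : ℝ := ((n + 1 : ℕ) : ℝ) / Ω ^ α with hl
  have h1 : HasDerivAt (fun u : ℝ => l * u ^ ((α : ℝ) / 2))
      (l * ((α : ℝ) / 2 * u ^ ((α : ℝ) / 2 - 1))) u :=
    (Real.hasDerivAt_rpow_const (Or.inl hu.ne')).const_mul l
  have h2 := ((hasDerivAt_exp_neg_mul_sum n (l * u ^ ((α : ℝ) / 2))).comp u h1).neg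
  refine h2.congr_deriv ?_
  rw [alphaMuGainPDF_of_pos hu, ← hl, alphaMuGainConst, Nat.cast_add, Nat.cast_one,
    Real.Gamma_nat_eq_factorial, mul_pow, ← Real.rpow_mul_natCast hu.le]
  have e : u ^ ((α : ℝ) * (n + 1) / 2 - 1) =
      u ^ ((α : ℝ) / 2 * n) * u ^ ((α : ℝ) / 2 - 1) := by
    rw [← Real.rpow_add hu]; ring_nf
  have e2 : l ^ n * l = ((n : ℝ) + 1) ^ (n + 1) / Ω ^ (α * (n + 1)) := by
    rw [← pow_succ, hl, div_pow, ← pow_mul]; push_cast; rfl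
  rw [e]
  calc _ = (l ^ n * l) * (Real.exp (-(l * u ^ ((α : ℝ) / 2))) * u ^ ((α : ℝ) / 2 * n) *
        u ^ ((α : ℝ) / 2 - 1)) * (α / (2 * n.factorial)) := by ring
    _ = _ := by
      rw [e2]
      have : (n.factorial : ℝ) ≠ 0 := by exact_mod_cast n.factorial_ne_zero
      field_simp

theorem tendsto_alphaMuGainTail (hα : 0 < α) (hμ : 0 < μ) (hΩ : 0 < Ω) :
    Tendsto (fun u => alphaMuGainTail α μ Ω u) atTop (𝓝 0) := by
  have hα' : (0 : ℝ) < α := by exact_mod_cast hα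
  have hμ' : (0 : ℝ) < μ := by exact_mod_cast hμ
  have h1 : Tendsto (fun v : ℝ => Real.exp (-v) *
      ∑ m ∈ Finset.range μ, v ^ m / (m.factorial : ℝ)) atTop (𝓝 0) := by
    have h2 : Tendsto (fun v : ℝ => ∑ m ∈ Finset.range μ,
        v ^ m * Real.exp (-v) / (m.factorial : ℝ)) atTop
        (𝓝 (∑ m ∈ Finset.range μ, 0 / (m.factorial : ℝ))) :=
      tendsto_finsetSum _ fun m _ =>
        (Real.tendsto_pow_mul_exp_neg_atTop_nhds_zero m).div_const _
    simp only [zero_div, Finset.sum_const_zero] at h2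
    refine h2.congr fun v => ?_
    rw [Finset.mul_sum]
    exact Finset.sum_congr rfl fun m _ => by ring
  exact h1.comp ((tendsto_rpow_atTop (by positivity)).const_mul_atTop (by positivity))

theorem alphaMuGainLaw_real_Ioi (hα : 0 < α) (hμ : 0 < μ) (hΩ : 0 < Ω) {u : ℝ} (hu : 0 < u) :
    (alphaMuGainLaw α μ Ω).real (Set.Ioi u) = alphaMuGainTail α μ Ω u := by
  have hα' : (0 : ℝ) < α := by exact_mod_cast hα
  have hμ' : (0 : ℝ) < μ := by exact_mod_cast hμ
  have hsub : Set.Ioi u ⊆ Set.Ioi 0 := Set.Ioi_subset_Ioi hu.le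
  have hint : IntegrableOn (alphaMuGainPDF α μ Ω) (Set.Ioi 0) := by
    refine IntegrableOn.congr_fun ((integrableOn_rpow_mul_exp_neg_mul_rpow_of_pos
      (p := (α : ℝ) / 2) (q := (α : ℝ) * μ / 2 - 1) (b := μ / Ω ^ α) (by positivity)
      (by have : 0 < (α : ℝ) * μ / 2 := by positivity
          linarith) (by positivity)).const_mul (alphaMuGainConst α μ Ω))
      (fun x hx => ?_) measurableSet_Ioi
    rw [alphaMuGainPDF_of_pos hx, neg_mul]
  -- The tail is recovered from its derivative and its limit 0 at infinity, so the total mass of the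
  -- density is not needed.
  have h1 := integral_Ioi_of_hasDerivAt_of_tendsto'
    (fun x hx => hasDerivAt_alphaMuGainTail (α := α) hμ hΩ (lt_of_lt_of_le hu hx))
    (hint.mono_set hsub) (tendsto_alphaMuGainTail hα hμ hΩ).neg
  rw [← integral_indicator_one measurableSet_Ioi, integral_alphaMuGainLaw hΩ]
  have h2 : ∀ x, alphaMuGainPDF α μ Ω x * (Set.Ioi u).indicator 1 x =
      (Set.Ioi u).indicator (alphaMuGainPDF α μ Ω) x := by
    intro x
    by_cases hx : x ∈ Set.Ioi u <;> simp [hx]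
  simp_rw [h2]
  rw [setIntegral_indicator measurableSet_Ioi, Set.inter_eq_self_of_subset_right hsub, h1]
  ring

theorem alphaMuGainLaw_real_Ici (hα : 0 < α) (hμ : 0 < μ) (hΩ : 0 < Ω) {u : ℝ} (hu : 0 < u) :
    (alphaMuGainLaw α μ Ω).real (Set.Ici u) = alphaMuGainTail α μ Ω u := by
  rw [← alphaMuGainLaw_real_Ioi hα hμ hΩ hu, Measure.real, Measure.real]
  have hac : alphaMuGainLaw α μ Ω ≪ volume := withDensity_absolutelyContinuous _ _
  rw [measure_congr (hac.ae_le Ioi_ae_eq_Ici.symm)]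

/-- The m-th term of the tail multiplies the density by u^(αm/2), which raises μ to μ + m, and the
exponentials multiply, which adds the rates. -/
theorem integral_tail_mul_log_one_add_mul {Ω' : ℝ} (hα : 0 < α) (hμ : 0 < μ) (hΩ : 0 < Ω)
    (hΩ' : 0 < Ω') {x : ℝ} (hx : 0 < x) :
    ∫ u in Set.Ioi (0 : ℝ),
        alphaMuGainPDF α μ Ω u * (alphaMuGainTail α μ Ω' u * Real.log (1 + x * u)) =
      alphaMuGainConst α μ Ω * ∑ m ∈ Finset.range μ,
        (μ / Ω' ^ α) ^ m / (m.factorial : ℝ) *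
          logGammaIntegral α (μ + m) x (μ / Ω ^ α + μ / Ω' ^ α) := by
  have hα' : (0 : ℝ) < α := by exact_mod_cast hα
  have hμ' : (0 : ℝ) < μ := by exact_mod_cast hμ
  simp_rw [logGammaIntegral, ← integral_const_mul]
  rw [← integral_finsetSum, ← integral_const_mul]
  · refine setIntegral_congr_fun measurableSet_Ioi fun u hu => ?_
    have hu' : 0 < u := hu
    rw [alphaMuGainPDF_of_pos hu', alphaMuGainTail, mul_assoc]
    congr 1
    simp only [Finset.mul_sum, Finset.sum_mul]
    refine Finset.sum_congr rfl fun m _ => ?_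
    have e : u ^ ((α : ℝ) * ((μ + m : ℕ) : ℝ) / 2 - 1) =
        u ^ ((α : ℝ) * μ / 2 - 1) * u ^ ((α : ℝ) / 2 * m) := by
      rw [← Real.rpow_add hu']; push_cast; ring_nf
    have e2 : Real.exp (-((μ / Ω ^ α + μ / Ω' ^ α) * u ^ ((α : ℝ) / 2))) =
        Real.exp (-(μ / Ω ^ α * u ^ ((α : ℝ) / 2))) *
          Real.exp (-(μ / Ω' ^ α * u ^ ((α : ℝ) / 2))) := by
      rw [← Real.exp_add]; ring_nf
    rw [e, e2, mul_pow, ← Real.rpow_mul_natCast hu'.le]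
    ring
  · intro m _
    refine Integrable.const_mul ?_ _
    exact integrableOn_log_one_add_mul (by positivity) (by positivity) hx (by positivity)

end Law

/-- Expectation of `log (1 + x min)` for two independent gains. -/
theorem integral_log_one_add_mul_min {S : Type*} [MeasurableSpace S] {P : Measure S}
    [IsProbabilityMeasure P] {α μ : ℕ} (hα : 0 < α) (hμ : 0 < μ) {Ω₁ Ω₂ : ℝ} (h1 : 0 < Ω₁)
    (h2 : 0 < Ω₂) {X Y : S → ℝ} (hX : HasLaw X (alphaMuGainLaw α μ Ω₁) P)
    (hY : HasLaw Y (alphaMuGainLaw α μ Ω₂) P) (hXY : IndepFun X Y P) {x : ℝ} (hx : 0 < x) :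
    Integrable (fun ω => Real.log (1 + x * min (Y ω) (X ω))) P ∧
    ∫ ω, Real.log (1 + x * min (Y ω) (X ω)) ∂P =
      alphaMuGainConst α μ Ω₁ * ∑ m ∈ Finset.range μ,
        (μ / Ω₂ ^ α) ^ m / (m.factorial : ℝ) *
          logGammaIntegral α (μ + m) x (μ / Ω₁ ^ α + μ / Ω₂ ^ α) +
      alphaMuGainConst α μ Ω₂ * ∑ m ∈ Finset.range μ,
        (μ / Ω₁ ^ α) ^ m / (m.factorial : ℝ) *
          logGammaIntegral α (μ + m) x (μ / Ω₁ ^ α + μ / Ω₂ ^ α) := by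
  set ν₁ := alphaMuGainLaw α μ Ω₁ with hν₁
  set ν₂ := alphaMuGainLaw α μ Ω₂ with hν₂
  -- Normalisation of the laws is inherited from P rather than computed.
  have hp1 : IsProbabilityMeasure ν₁ := hX.isProbabilityMeasure_iff.1 inferInstance
  have hp2 : IsProbabilityMeasure ν₂ := hY.isProbabilityMeasure_iff.1 inferInstance
  set φ : ℝ → ℝ := fun u => Real.log (1 + x * u) with hφ
  have hφm : Measurable φ := by fun_prop
  have hlaw : P.map (fun ω => (X ω, Y ω)) = ν₁.prod ν₂ := by
    rw [(indepFun_iff_map_prod_eq_prod_map_map hX.aemeasurable hY.aemeasurable).1 hXY, hX.map_eq,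
      hY.map_eq]
  have hpm : AEMeasurable (fun ω => (X ω, Y ω)) P := hX.aemeasurable.prodMk hY.aemeasurable
  have hi1 : Integrable φ ν₁ := integrable_log_one_add_mul_alphaMuGainLaw hα hμ h1 hx
  have hi2 : Integrable φ ν₂ := integrable_log_one_add_mul_alphaMuGainLaw hα hμ h2 hx
  -- Ties go to the complement, so its slices are closed half-lines; the law is absolutely
  -- continuous, so the tail is the same.
  set A : Set (ℝ × ℝ) := {q | q.1 < q.2} with hA
  have hAm : MeasurableSet A := measurableSet_lt measurable_fst measurable_snd
  have hsplit : (fun q : ℝ × ℝ => φ (min q.2 q.1)) =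
      fun q => A.indicator (fun q => φ q.1) q + Aᶜ.indicator (fun q => φ q.2) q := by
    ext q
    by_cases hq : q ∈ A
    · have : q.1 < q.2 := hq
      simp [hq, min_eq_right this.le]
    · have : q.2 ≤ q.1 := not_lt.1 hq
      simp [hq, min_eq_left this]
  have hI1 : Integrable (A.indicator fun q : ℝ × ℝ => φ q.1) (ν₁.prod ν₂) :=
    (hi1.comp_fst ν₂).indicator hAm
  have hI2 : Integrable (Aᶜ.indicator fun q : ℝ × ℝ => φ q.2) (ν₁.prod ν₂) :=
    (hi2.comp_snd ν₁).indicator hAm.compl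
  have hI : Integrable (fun q : ℝ × ℝ => φ (min q.2 q.1)) (ν₁.prod ν₂) := by
    rw [hsplit]; exact hI1.add hI2
  refine ⟨?_, ?_⟩
  · rw [← hlaw] at hI
    exact hI.comp_aemeasurable hpm
  have hE : ∫ ω, φ (min (Y ω) (X ω)) ∂P = ∫ q, φ (min q.2 q.1) ∂(ν₁.prod ν₂) := by
    rw [← hlaw, integral_map hpm (Measurable.aestronglyMeasurable (by fun_prop))]
  change ∫ ω, φ (min (Y ω) (X ω)) ∂P = _
  rw [hE, hsplit, integral_add hI1 hI2, integral_prod _ hI1, integral_prod_symm _ hI2]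
  congr 1
  · rw [← integral_tail_mul_log_one_add_mul hα hμ h1 h2 hx, hν₁,
      integral_alphaMuGainLaw h1]
    refine setIntegral_congr_fun measurableSet_Ioi fun u hu => ?_
    congr 1
    have : ∀ v, A.indicator (fun q : ℝ × ℝ => φ q.1) (u, v) =
        (Set.Ioi u).indicator (fun _ => φ u) v := fun v => by
      simp [Set.indicator_apply, hA]
    simp_rw [this]
    rw [integral_indicator_const _ measurableSet_Ioi, alphaMuGainLaw_real_Ioi hα hμ h2 hu,
      smul_eq_mul]
  · rw [add_comm (μ / Ω₁ ^ α : ℝ), ← integral_tail_mul_log_one_add_mul hα hμ h2 h1 hx, hν₂,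
      integral_alphaMuGainLaw h2]
    refine setIntegral_congr_fun measurableSet_Ioi fun u hu => ?_
    congr 1
    have : ∀ v, Aᶜ.indicator (fun q : ℝ × ℝ => φ q.2) (v, u) =
        (Set.Ici u).indicator (fun _ => φ u) v := fun v => by
      simp [Set.indicator_apply, hA]
    simp_rw [this]
    rw [integral_indicator_const _ measurableSet_Ici, alphaMuGainLaw_real_Ici hα hμ h1 hu,
      smul_eq_mul]

/-! ### Matching the constants of the closed forms -/

theorem sqrt_two_mul_two_pi_rpow {α : ℕ} (hα : 0 < α) :
    √2 * (2 * Real.pi) ^ ((α : ℝ) - 1 / 2) = 2 * √Real.pi * (2 * Real.pi) ^ (α - 1) := by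
  have h2pi : 0 < 2 * Real.pi := by positivity
  have e : ((α : ℝ) - 1 / 2) = ((α - 1 : ℕ) : ℝ) + 1 / 2 := by
    rw [Nat.cast_sub hα]; push_cast; ring
  rw [e, Real.rpow_add h2pi, Real.rpow_natCast, ← Real.sqrt_eq_rpow, Real.sqrt_mul zero_le_two]
  linear_combination √Real.pi * (2 * Real.pi) ^ (α - 1) * Real.mul_self_sqrt zero_le_two

/-- The factor in front of J in the G-function, divided by the constant in the closed forms, leaves
the α/2 of the normalised density. -/
theorem meijerG_prefactor_div {α : ℕ} (hα : 0 < α) :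
    √Real.pi * α * (2 * Real.pi) ^ (α - 1) / (√2 * (2 * Real.pi) ^ ((α : ℝ) - 1 / 2)) = α / 2 := by
  have := Real.pi_pos
  rw [sqrt_two_mul_two_pi_rpow hα]
  field_simp

theorem strongArg_eq (α μ : ℕ) (Ω a : NOMAUser → ℝ) (ρ : ℝ) :
    strongArg α μ Ω a ρ =
      1 / (a NOMAUser.s * ρ) ^ α * (μ / Ω NOMAUser.s ^ α / 2) ^ 2 := by
  rw [strongArg, div_div, mul_comm (2 : ℝ)]

/-- μ/Ω̃ is the sum of the two exponential rates, which is the l of the weak user's integrals. -/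
theorem weakArg_eq (α μ : ℕ) (Ω : NOMAUser → ℝ) (x : ℝ) :
    weakArg α μ Ω x =
      1 / x ^ α * ((μ / Ω NOMAUser.s ^ α + μ / Ω NOMAUser.w ^ α) / 2) ^ 2 := by
  rw [weakArg, omegaTilde, mul_one_div, div_div_eq_mul_div]
  ring

theorem strongClosedForm_eq {α μ : ℕ} (hα : 0 < α) (hμ : 0 < μ) {Ω a : NOMAUser → ℝ} {ρ : ℝ}
    (hΩ : 0 < Ω NOMAUser.s) (hx : 0 < a NOMAUser.s * ρ) :
    strongClosedForm α μ Ω a ρ =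
      ((alphaMuGainConst α μ (Ω NOMAUser.s) *
        logGammaIntegral α μ (a NOMAUser.s * ρ) (μ / Ω NOMAUser.s ^ α) / Real.log 2 : ℝ) : ℂ) := by
  have hμ' : (0 : ℝ) < μ := by exact_mod_cast hμ
  have hl2 : 0 < Real.log 2 := Real.log_pos one_lt_two
  have hΓ : 0 < Real.Gamma μ := Real.Gamma_pos_of_pos hμ'
  have hpi := Real.pi_pos
  rw [strongClosedForm, strongArg_eq,
    (meijerG_wellDefined hα hμ hx (l := μ / Ω NOMAUser.s ^ α) (by positivity)).2]
  rw [← Complex.ofReal_natCast, ← Complex.ofReal_pow, ← Complex.ofReal_mul, ← Complex.ofReal_div]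
  congr 1
  set J := logGammaIntegral α μ (a NOMAUser.s * ρ) (μ / Ω NOMAUser.s ^ α)
  have hA := Real.rpow_pos_of_pos hx ((α : ℝ) * μ / 2)
  calc _ = √Real.pi * α * (2 * Real.pi) ^ (α - 1) / (√2 * (2 * Real.pi) ^ ((α : ℝ) - 1 / 2)) *
        (μ ^ μ * J / (Real.log 2 * Real.Gamma μ * Ω NOMAUser.s ^ (α * μ))) := by
        field_simp
    _ = _ := by
        rw [meijerG_prefactor_div hα, alphaMuGainConst]; field_simp

theorem weakBracket_eq {α μ : ℕ} (hα : 0 < α) (hμ : 0 < μ) {Ω a : NOMAUser → ℝ} {ρ : ℝ}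
    (hΩ : ∀ i, 0 < Ω i) (hρ : 0 < ρ) (hx : 0 < a NOMAUser.s * ρ) (y : ℕ) :
    weakBracket α μ Ω a ρ y =
      ((√Real.pi * α * (2 * Real.pi) ^ (α - 1) *
        (logGammaIntegral α (μ + y) ρ (μ / Ω NOMAUser.s ^ α + μ / Ω NOMAUser.w ^ α) -
          logGammaIntegral α (μ + y) (a NOMAUser.s * ρ)
            (μ / Ω NOMAUser.s ^ α + μ / Ω NOMAUser.w ^ α)) : ℝ) : ℂ) := by
  have hμ' : (0 : ℝ) < μ := by exact_mod_cast hμ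
  have hs := hΩ NOMAUser.s
  have hw := hΩ NOMAUser.w
  have hl : 0 < μ / Ω NOMAUser.s ^ α + μ / Ω NOMAUser.w ^ α := by positivity
  have key : ∀ {x : ℝ}, 0 < x →
      weakG α μ Ω x y / ((x ^ ((α : ℝ) * ((μ : ℝ) + (y : ℝ)) / 2) : ℝ) : ℂ) =
        ((√Real.pi * α * (2 * Real.pi) ^ (α - 1) *
          logGammaIntegral α (μ + y) x (μ / Ω NOMAUser.s ^ α + μ / Ω NOMAUser.w ^ α) : ℝ) : ℂ) := by
    intro x hx
    rw [weakG, weakArg_eq, (meijerG_wellDefined hα (by omega : 0 < μ + y) hx hl).2,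
      ← Complex.ofReal_div, Nat.cast_add]
    congr 1
    have := Real.rpow_pos_of_pos hx ((α : ℝ) * ((μ : ℝ) + (y : ℝ)) / 2)
    field_simp
  rw [weakBracket, key hρ, key hx, ← Complex.ofReal_sub, mul_sub]

theorem weakClosedForm_eq {α μ : ℕ} (hα : 0 < α) (hμ : 0 < μ) {Ω a : NOMAUser → ℝ} {ρ : ℝ}
    (hΩ : ∀ i, 0 < Ω i) (hρ : 0 < ρ) (hx : 0 < a NOMAUser.s * ρ) :
    weakClosedForm α μ Ω a ρ =
      (((alphaMuGainConst α μ (Ω NOMAUser.s) * ∑ m ∈ Finset.range μ,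
          (μ / Ω NOMAUser.w ^ α) ^ m / (m.factorial : ℝ) *
            (logGammaIntegral α (μ + m) ρ (μ / Ω NOMAUser.s ^ α + μ / Ω NOMAUser.w ^ α) -
              logGammaIntegral α (μ + m) (a NOMAUser.s * ρ)
                (μ / Ω NOMAUser.s ^ α + μ / Ω NOMAUser.w ^ α)) +
        alphaMuGainConst α μ (Ω NOMAUser.w) * ∑ m ∈ Finset.range μ,
          (μ / Ω NOMAUser.s ^ α) ^ m / (m.factorial : ℝ) *
            (logGammaIntegral α (μ + m) ρ (μ / Ω NOMAUser.s ^ α + μ / Ω NOMAUser.w ^ α) -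
              logGammaIntegral α (μ + m) (a NOMAUser.s * ρ)
                (μ / Ω NOMAUser.s ^ α + μ / Ω NOMAUser.w ^ α))) / Real.log 2 : ℝ) : ℂ) := by
  have hμ' : (0 : ℝ) < μ := by exact_mod_cast hμ
  have hl2 : 0 < Real.log 2 := Real.log_pos one_lt_two
  have hΓ : 0 < Real.Gamma μ := Real.Gamma_pos_of_pos hμ'
  have hs := hΩ NOMAUser.s
  have hw := hΩ NOMAUser.w
  set D : ℕ → ℝ := fun m =>
    logGammaIntegral α (μ + m) ρ (μ / Ω NOMAUser.s ^ α + μ / Ω NOMAUser.w ^ α) -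
      logGammaIntegral α (μ + m) (a NOMAUser.s * ρ)
        (μ / Ω NOMAUser.s ^ α + μ / Ω NOMAUser.w ^ α) with hD
  set K : ℝ := √Real.pi * α * (2 * Real.pi) ^ (α - 1) with hK
  -- Stated for arbitrary O and O' so that both halves of the formula follow by exchanging the
  -- users.
  have hsum : ∀ O : ℝ, 0 < O → ∀ O' : ℝ, 0 < O' →
      1 / (√2 * Real.log 2 * (2 * Real.pi) ^ ((α : ℝ) - 1 / 2) * Real.Gamma (μ : ℝ)) *
        (1 / O ^ (α * μ) * ∑ m ∈ Finset.range μ,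
          (μ : ℝ) ^ (μ + m) / ((m.factorial : ℝ) * O' ^ (m * α)) * (K * D m)) =
      alphaMuGainConst α μ O * (∑ m ∈ Finset.range μ,
          (μ / O' ^ α) ^ m / (m.factorial : ℝ) * D m) / Real.log 2 := by
    intro O hO O' hO'
    have hc := meijerG_prefactor_div hα
    rw [← hK] at hc
    have hterm : ∀ m : ℕ, (μ : ℝ) ^ (μ + m) / ((m.factorial : ℝ) * O' ^ (m * α)) * (K * D m) =
        K * μ ^ μ * ((μ / O' ^ α) ^ m / (m.factorial : ℝ) * D m) := by
      intro m
      rw [div_pow, ← pow_mul, mul_comm α m, pow_add]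
      field_simp
    simp_rw [hterm]
    rw [← Finset.mul_sum]
    set W := ∑ m ∈ Finset.range μ, (μ / O' ^ α) ^ m / (m.factorial : ℝ) * D m
    calc _ = K / (√2 * (2 * Real.pi) ^ ((α : ℝ) - 1 / 2)) *
          (μ ^ μ * W / (Real.log 2 * Real.Gamma μ * O ^ (α * μ))) := by
          field_simp
      _ = _ := by
          rw [hc, alphaMuGainConst]; field_simp
  have hbr : ∀ m, weakBracket α μ Ω a ρ m = ((K * D m : ℝ) : ℂ) :=
    weakBracket_eq hα hμ hΩ hρ hx
  rw [weakClosedForm]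
  simp_rw [hbr]
  rw [add_div, ← hsum _ hs _ hw, ← hsum _ hw _ hs]
  push_cast
  ring

/-! ### The ergodic rates of the two users -/

section Rates

variable {S : Type*} [MeasurableSpace S] {P : Measure S}
  {α μ : ℕ} {Ω a : NOMAUser → ℝ} {ρ : ℝ} {h : NOMAUser → S → ℂ}

theorem sinr_nonneg {S : Type*} {a : NOMAUser → ℝ} {ρ : ℝ} {h : NOMAUser → S → ℂ}
    (hapos : ∀ i, 0 < a i) (hρ : 0 < ρ) (i : NOMAUser) (ω : S) :
    0 ≤ sinr a ρ h i ω := by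
  have hs := hapos NOMAUser.s
  have hw := hapos NOMAUser.w
  have hg : ∀ i, 0 ≤ channelGain h i ω := fun i => sq_nonneg _
  have hm : 0 ≤ minGain h ω := le_min (hg _) (hg _)
  cases i
  · have := hg NOMAUser.s
    simp only [sinr]; positivity
  · simp only [sinr]; positivity

/-- Because a_s + a_w = 1, 1 + γ_w = (1 + ρ g_min)/(1 + a_s ρ g_min). This is the source of the
differences in the weak user's closed form. -/
theorem log_one_add_sinr_weak {S : Type*} {a : NOMAUser → ℝ} {ρ : ℝ} {h : NOMAUser → S → ℂ}
    (hapos : ∀ i, 0 < a i) (hasum : a NOMAUser.s + a NOMAUser.w = 1) (hρ : 0 < ρ) (ω : S) :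
    Real.log (1 + sinr a ρ h NOMAUser.w ω) =
      Real.log (1 + ρ * min (channelGain h NOMAUser.w ω) (channelGain h NOMAUser.s ω)) -
        Real.log (1 + a NOMAUser.s * ρ *
          min (channelGain h NOMAUser.w ω) (channelGain h NOMAUser.s ω)) := by
  have hs := hapos NOMAUser.s
  have hg : ∀ i, 0 ≤ channelGain h i ω := fun i => sq_nonneg _
  have hm : 0 ≤ min (channelGain h NOMAUser.w ω) (channelGain h NOMAUser.s ω) :=
    le_min (hg _) (hg _)
  simp only [sinr, minGain]
  set g := min (channelGain h NOMAUser.w ω) (channelGain h NOMAUser.s ω)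
  rw [← Real.log_div (by positivity) (by positivity)]
  congr 1
  have : a NOMAUser.s * ρ * g + 1 ≠ 0 := by positivity
  rw [add_comm 1 (a NOMAUser.s * ρ * g), eq_div_iff this, add_mul, div_mul_cancel₀ _ this]
  linear_combination ρ * g * hasum

theorem integrable_and_ergodicRate_strong (hα : 0 < α) (hμ : 0 < μ) (hΩ : 0 < Ω NOMAUser.s)
    (hx : 0 < a NOMAUser.s * ρ)
    (hlaw : HasLaw (channelGain h NOMAUser.s) (alphaMuGainLaw α μ (Ω NOMAUser.s)) P) :
    Integrable (fun ω => Real.log (1 + sinr a ρ h NOMAUser.s ω)) P ∧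
      (ergodicRate P a ρ h NOMAUser.s : ℂ) = strongClosedForm α μ Ω a ρ := by
  have hi := integrable_log_one_add_mul_alphaMuGainLaw hα hμ hΩ hx
  refine ⟨?_, ?_⟩
  · rw [← hlaw.map_eq] at hi
    exact hi.comp_aemeasurable hlaw.aemeasurable
  · rw [strongClosedForm_eq hα hμ hΩ hx, ergodicRate_eq_integral_log_div,
      ← integral_log_one_add_mul_alphaMuGainLaw hΩ, ← hlaw.integral_comp hi.1]
    rfl

theorem integrable_and_ergodicRate_weak [IsProbabilityMeasure P] (hα : 0 < α) (hμ : 0 < μ)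
    (hΩ : ∀ i, 0 < Ω i)
    (hapos : ∀ i, 0 < a i) (hasum : a NOMAUser.s + a NOMAUser.w = 1) (hρ : 0 < ρ)
    (hlaw : ∀ i, HasLaw (channelGain h i) (alphaMuGainLaw α μ (Ω i)) P)
    (hindep : IndepFun (channelGain h NOMAUser.s) (channelGain h NOMAUser.w) P) :
    Integrable (fun ω => Real.log (1 + sinr a ρ h NOMAUser.w ω)) P ∧
      (ergodicRate P a ρ h NOMAUser.w : ℂ) = weakClosedForm α μ Ω a ρ := by
  have hx : 0 < a NOMAUser.s * ρ := mul_pos (hapos _) hρ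
  obtain ⟨i1, e1⟩ := integral_log_one_add_mul_min hα hμ (hΩ _) (hΩ _) (hlaw NOMAUser.s)
    (hlaw NOMAUser.w) hindep hρ
  obtain ⟨i2, e2⟩ := integral_log_one_add_mul_min hα hμ (hΩ _) (hΩ _) (hlaw NOMAUser.s)
    (hlaw NOMAUser.w) hindep hx
  rw [ergodicRate_eq_integral_log_div, weakClosedForm_eq hα hμ hΩ hρ hx]
  simp_rw [log_one_add_sinr_weak hapos hasum hρ]
  refine ⟨i1.sub i2, ?_⟩
  rw [integral_sub i1 i2, e1, e2]
  simp_rw [mul_sub, Finset.sum_sub_distrib, mul_sub]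
  congr 2
  ring

end Rates

end

theorem mainTheorem6
    {S : Type*} [MeasurableSpace S] (P : Measure S) [IsProbabilityMeasure P]
    (α μ : ℕ) (hα : 0 < α) (hμ : 0 < μ)
    (Ω : NOMAUser → ℝ) (hΩpos : ∀ i, 0 < Ω i)
    (hΩ : Ω NOMAUser.w ^ α < Ω NOMAUser.s ^ α)
    (a : NOMAUser → ℝ) (hapos : ∀ i, 0 < a i)
    (ha : a NOMAUser.s < a NOMAUser.w) (hasum : a NOMAUser.s + a NOMAUser.w = 1)
    (ρ T B : ℝ) (hρ : 0 < ρ) (hT : 0 < T) (hB : 0 < B)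
    (h : NOMAUser → S → ℂ)
    (hlaw : ∀ i, HasLaw (channelGain h i) (alphaMuGainLaw α μ (Ω i)) P)
    (hindep : IndepFun (channelGain h NOMAUser.s) (channelGain h NOMAUser.w) P) :
    -- all expectations are genuine, and the effective rates are bounded by the ergodic rates
    (∀ i, Integrable (fun ω => Real.logb 2 (1 + sinr a ρ h i ω)) P ∧
      (∀ θ : ℝ, 0 < θ →
        Integrable (fun ω => (1 + sinr a ρ h i ω) ^ (-qosNu θ T B)) P ∧
        effectiveRate P a ρ T B h i θ ≤
          -(1 / qosNu θ T B) *
            ∫ ω, Real.logb 2 ((1 + sinr a ρ h i ω) ^ (-qosNu θ T B)) ∂P ∧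
        -(1 / qosNu θ T B) *
            ∫ ω, Real.logb 2 ((1 + sinr a ρ h i ω) ^ (-qosNu θ T B)) ∂P =
          ergodicRate P a ρ h i ∧
        effectiveRate P a ρ T B h i θ ≤ ergodicRate P a ρ h i) ∧
      Tendsto (fun θ : ℝ => effectiveRate P a ρ T B h i θ) (𝓝[>] 0)
        (𝓝 (ergodicRate P a ρ h i))) ∧
    -- closed form for the strong user
    MeijerGWellDefined (2 + 2 * α) α (upperParams α μ) (lowerParams α μ)
      (strongArg α μ Ω a ρ : ℂ) ∧
    (ergodicRate P a ρ h NOMAUser.s : ℂ) = strongClosedForm α μ Ω a ρ ∧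
    -- closed form for the weak user
    (∀ y < μ, ∀ x ∈ ({ρ, a NOMAUser.s * ρ} : Set ℝ),
      MeijerGWellDefined (2 + 2 * α) α (upperParams α (μ + y)) (lowerParams α (μ + y))
        (weakArg α μ Ω x : ℂ)) ∧
    (ergodicRate P a ρ h NOMAUser.w : ℂ) = weakClosedForm α μ Ω a ρ ∧
    -- the bound on the sum effective rate, by the sum of the closed forms
    (∀ θ : ℝ, 0 < θ →
      sumEffectiveRate P a ρ T B h θ ≤ ergodicSumRate P a ρ h) ∧
    (ergodicSumRate P a ρ h : ℂ) =
      strongClosedForm α μ Ω a ρ + weakClosedForm α μ Ω a ρ := by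
  have hs := hΩpos NOMAUser.s
  have hw := hΩpos NOMAUser.w
  have hμ' : (0 : ℝ) < μ := by exact_mod_cast hμ
  have hx : 0 < a NOMAUser.s * ρ := mul_pos (hapos _) hρ
  obtain ⟨is, es⟩ := integrable_and_ergodicRate_strong hα hμ hs hx (hlaw NOMAUser.s)
  obtain ⟨iw, ew⟩ := integrable_and_ergodicRate_weak hα hμ hΩpos hapos hasum hρ hlaw hindep
  have hrates := fun i => effectiveRate_bounds (P := P) (h := h) (i := i)
    (sinr_nonneg hapos hρ i) (by cases i <;> assumption) hT hB
  refine ⟨hrates, ?_, es, ?_, ew, fun θ hθ => ?_, ?_⟩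
  · rw [strongArg_eq]
    exact (meijerG_wellDefined hα hμ hx (by positivity)).1
  · intro y _ x hxm
    have hxpos : 0 < x := by
      rcases hxm with rfl | rfl
      exacts [hρ, hx]
    rw [weakArg_eq]
    exact (meijerG_wellDefined hα (by omega) hxpos (by positivity)).1
  · exact add_le_add ((hrates _).2.1 θ hθ).2.2.2 ((hrates _).2.1 θ hθ).2.2.2
  · rw [ergodicSumRate, Complex.ofReal_add, es, ew]
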